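/- All Banach spaces are real. Let $X$ be a Banach space and $D\subseteq X^*$. The set $D$ is \emph{1-norming} if $\|x\|=\sup\{|\varphi(x)|/\|\varphi\| : \varphi\in D\setminus\{0\}\}$ for every $x\in X$ (with $\sup\emptyset=0$). The set $D$ \emph{generates projections in $X$} if for every big enough regular cardinal $\theta$ and every countable elementary substructure $M\preceq (H(\theta),\in)$ with $X,D\in M$, we have $$X=X_M\oplus{}^\perp(D\cap M),\qquad X_M=\operatorname{cl}(X\cap M),\quad {}^\perp B=\{x\in X:\varphi(x)=0\text{ for all }\varphi\in B\},$$ where $H(\theta)$ is the set of all sets whose transitive closure has cardinality $<\theta$. A \emph{1-projectional skeleton} in $X$ is a family $(P_s)_{s\in\Gamma}$ of bounded projections of $X$ with $\|P_s\|\le 1$, indexed by a directed partially ordered set $\Gamma$, such that (1) $X=\bigcup_{s}P_sX$ and each $P_sX$ is separable; (2) $s\le t$ implies $P_s=P_sP_t=P_tP_s$; (3) if $s_0<s_1<\cdots$ in $\Gamma$, then $t=\sup_n s_n$ exists in $\Gamma$ and $P_tX=\operatorname{cl}(\bigcup_n P_{s_n}X)$. \textbf{Theorem.} Let $(X_\alpha)_{\alpha\in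 I}$ be a family of Banach spaces, and let $X=\bigoplus_{\alpha\in I}X_\alpha$ be its $c_0$-sum or its $\ell_p$-sum, where $1\le p<\infty$. (a) For each $\alpha$ let $D_\alpha\subseteq X_\alpha^*$ be a 1-norming set that generates projections in $X_\alpha$, with $0\in D_\alpha$. In the case of an $\ell_p$-sum assume moreover that $q\varphi\in D_\alpha$ whenever $\varphi\in D_\alpha$ and $q$ is a rational number with $|q|\le 1$. (Both additional conditions hold if $D_\alpha$ is a linear, or $\mathbb Q$-linear, subspace.) Then the set $$D=\bigl\{\varphi\in X^* : \varphi\restriction X_\alpha\in D_\alpha\text{ for all }\alpha,\ \text{and } \{\alpha : \varphi\restriction X_\alpha\neq 0\}\text{ is countable}\bigr\}$$ is 1-norming and generates projections in $X$. (b) If every $X_\alpha$ has a 1-projectional skeleton, then $X$ has a 1-projectional skeleton. -/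

import Mathlib

open scoped ENNReal Topology

universe u

namespace ProjSkel

noncomputable section

/-! ### The structure `(H(θ), ∈)` and its elementary substructures -/

/-- The relation symbols of the language of set theory: one binary symbol. -/
inductive SetRel : ℕ → Type
  | mem : SetRel 2

/-- The first-order language of set theory (equality is part of the logic). -/
def setLanguage : FirstOrder.Language.{0, 0} := ⟨fun _ => Empty, SetRel⟩

/-- The transitive closure of `x`: all `y` with `y ∈ x₀ ∈ ⋯ ∈ xₖ ∈ x` or `y ∈ x`. -/
def transitiveClosure (x : ZFSet.{u}) : Set ZFSet.{u} :=
  {y | Relation.TransGen (fun a b : ZFSet.{u} => a ∈ b) y x}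

/-- `H(θ)`: the sets whose transitive closure has cardinality `< θ`. -/
def H (θ : Cardinal.{u}) : Type (u + 1) :=
  {x : ZFSet.{u} // Cardinal.mk (transitiveClosure x) < Cardinal.lift.{u + 1, u} θ}

/-- `H(θ)` as a structure for the language of set theory, with the true membership relation. -/
instance instStructureH (θ : Cardinal.{u}) : setLanguage.Structure (H θ) where
  funMap := fun f => nomatch f
  RelMap := fun {_} r => match r with
    | SetRel.mem => fun v => (v 0).1 ∈ (v 1).1

/-- The set `z` is an element of the elementary substructure `M` of `H(θ)`. -/
def MemModel {θ : Cardinal.{u}} (M : setLanguage.ElementarySubstructure (H θ))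
    (z : ZFSet.{u}) : Prop :=
  ∃ m : H θ, m ∈ M ∧ m.1 = z

/-! ### Normed spaces and sets of functionals as sets

Numbers are coded in the usual way (von Neumann naturals, differences, fractions, Dedekind cuts).
The points of a space `X` are identified with sets through an arbitrary injection `e`; operations
and functionals are then coded by their graphs. -/

/-- The von Neumann natural number `n`. -/
def natCode (n : ℕ) : ZFSet.{u} := Ordinal.toZFSet (n : Ordinal.{u})

/-- The integer `k` as the pair (positive part, negative part). -/
def intCode (k : ℤ) : ZFSet.{u} := ZFSet.pair (natCode k.toNat) (natCode (-k).toNat)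

/-- The rational `q` as the pair (numerator, denominator) in lowest terms. -/
def ratCode (q : ℚ) : ZFSet.{u} := ZFSet.pair (intCode q.num) (natCode q.den)

/-- The real `t` as the Dedekind cut of all rationals `q < t`. -/
def realCode (t : ℝ) : ZFSet.{u} := ZFSet.range fun q : {q : ℚ // (q : ℝ) < t} => ratCode q.1

section Codes

variable {X : Type u} [NormedAddCommGroup X] [NormedSpace ℝ X]

/-- The normed space `X`, realized on the set `e '' X`: the quadruple of its underlying set and
the graphs of its addition, its scalar multiplication and its norm. -/
def spaceCode (e : X ↪ ZFSet.{u}) : ZFSet.{u} :=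
  ZFSet.pair (ZFSet.range fun x : X => e x)
    (ZFSet.pair (ZFSet.range fun z : X × X => ZFSet.pair (ZFSet.pair (e z.1) (e z.2)) (e (z.1 + z.2)))
      (ZFSet.pair
        (ZFSet.range fun z : ℝ × X => ZFSet.pair (ZFSet.pair (realCode z.1) (e z.2)) (e (z.1 • z.2)))
        (ZFSet.range fun x : X => ZFSet.pair (e x) (realCode ‖x‖))))

/-- A functional on `X`, as its graph. -/
def functionalCode (e : X ↪ ZFSet.{u}) (φ : StrongDual ℝ X) : ZFSet.{u} :=
  ZFSet.range fun x : X => ZFSet.pair (e x) (realCode (φ x))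

/-- A set of functionals on `X`, as the set of their graphs. -/
def functionalSetCode (e : X ↪ ZFSet.{u}) (D : Set (StrongDual ℝ X)) : ZFSet.{u} :=
  ZFSet.range fun φ : D => functionalCode e φ.1

end Codes

/-! ### Norming sets and sets generating projections -/

section Norming

variable {X : Type u} [NormedAddCommGroup X] [NormedSpace ℝ X]

/-- `D` is 1-norming: `‖x‖ = sup {|φ x| / ‖φ‖ : φ ∈ D \ {0}}` for all `x`. The quotients are
always bounded by `‖x‖`; the supremum of the empty set of quotients is `0`. -/
def IsOneNorming (D : Set (StrongDual ℝ X)) : Prop :=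
  ∀ x : X, ‖x‖ = sSup ((fun φ : StrongDual ℝ X => |φ x| / ‖φ‖) '' (D \ {0}))

/-- The subspace of `X` annihilated by all members of `B`. -/
def leftAnnihilator (B : Set (StrongDual ℝ X)) : Submodule ℝ X where
  carrier := {x | ∀ φ ∈ B, φ x = 0}
  zero_mem' := fun φ _ => map_zero φ
  add_mem' := fun {x y} hx hy φ hφ => by rw [map_add, hx φ hφ, hy φ hφ, add_zero]
  smul_mem' := fun c x hx φ hφ => by rw [map_smul, hx φ hφ, smul_zero]

/-- `X_M`: the norm closure of `X ∩ M`. -/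
def inducedSubspace (e : X ↪ ZFSet.{u}) {θ : Cardinal.{u}}
    (M : setLanguage.ElementarySubstructure (H θ)) : Set X :=
  closure {x | MemModel M (e x)}

/-- `D ∩ M`. -/
def functionalsIn (e : X ↪ ZFSet.{u}) (D : Set (StrongDual ℝ X)) {θ : Cardinal.{u}}
    (M : setLanguage.ElementarySubstructure (H θ)) : Set (StrongDual ℝ X) :=
  {φ ∈ D | MemModel M (functionalCode e φ)}

/-- `D` generates projections in `X`: however `X` is realized as a set, for every big enough
regular cardinal `θ` and every countable `M ≼ (H(θ), ∈)` with `X, D ∈ M`, the set `X_M` is a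
linear subspace and `X` is the direct sum of `X_M` and the annihilator of `D ∩ M`. -/
def GeneratesProjections (D : Set (StrongDual ℝ X)) : Prop :=
  ∀ e : X ↪ ZFSet.{u}, ∃ θ₀ : Cardinal.{u}, ∀ θ : Cardinal.{u}, θ.IsRegular → θ₀ ≤ θ →
    ∀ M : setLanguage.ElementarySubstructure (H θ), (M : Set (H θ)).Countable →
      MemModel M (spaceCode e) → MemModel M (functionalSetCode e D) →
      ∃ Y : Submodule ℝ X, (Y : Set X) = inducedSubspace e M ∧
        IsCompl Y (leftAnnihilator (functionalsIn e D M))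

end Norming

/-! ### Projectional skeletons -/

/-- `(P s)_{s ∈ Γ}` is a projectional skeleton in `X`. -/
structure IsProjectionalSkeleton {X : Type*} [NormedAddCommGroup X] [NormedSpace ℝ X]
    {Γ : Type*} [PartialOrder Γ] (P : Γ → X →L[ℝ] X) : Prop where
  directed : ∀ s t : Γ, ∃ v, s ≤ v ∧ t ≤ v
  projection : ∀ s, (P s).comp (P s) = P s
  covers : ∀ x : X, ∃ s, x ∈ Set.range (P s)
  separable : ∀ s, TopologicalSpace.IsSeparable (Set.range (P s))
  compatible : ∀ s t, s ≤ t → (P s).comp (P t) = P s ∧ (P t).comp (P s) = P s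
  continuous_sup : ∀ s : ℕ → Γ, StrictMono s →
    ∃ t, IsLUB (Set.range s) t ∧ Set.range (P t) = closure (⋃ n, Set.range (P (s n)))

/-- `X` has an `r`-projectional skeleton: one whose projections have norm at most `r`. -/
def HasProjectionalSkeleton (r : ℝ) (X : Type u) [NormedAddCommGroup X] [NormedSpace ℝ X] : Prop :=
  ∃ (Γ : Type u) (_ : PartialOrder Γ) (P : Γ → X →L[ℝ] X),
    IsProjectionalSkeleton P ∧ ∀ s, ‖P s‖ ≤ r

/-! ### Sums of Banach spaces -/

section Sums

variable {ι : Type u} (X : ι → Type u) [∀ i, NormedAddCommGroup (X i)] [∀ i, NormedSpace ℝ (X i)]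

/-- The `c₀`-sum: families `x` with `‖x i‖ → 0` along the cofinite filter (i.e. `‖x i‖ ≥ ε` for
only finitely many `i`, for each `ε > 0`), with the supremum norm. -/
def c0Sum : Submodule ℝ (lp X ∞) where
  carrier := {x | Filter.Tendsto (fun i => ‖x i‖) Filter.cofinite (𝓝 0)}
  zero_mem' := by simpa using tendsto_const_nhds
  add_mem' := fun {x y} hx hy => by
    refine squeeze_zero (fun i => norm_nonneg _) (fun i => ?_) (by simpa using hx.add hy)
    simpa using norm_add_le (x i) (y i)
  smul_mem' := fun c x hx => by
    have h := Filter.Tendsto.const_mul ‖c‖ hx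
    simpa [norm_smul] using h

open Classical in
/-- The canonical embedding of `X i` into the `ℓ_p`-sum. -/
def lpIncl (p : ℝ≥0∞) [Fact (1 ≤ p)] (i : ι) : X i →L[ℝ] lp X p :=
  lp.singleContinuousLinearMap ℝ X p i

/-- The canonical embedding of `X i` into the `c₀`-sum. -/
def c0Incl (i : ι) : X i →L[ℝ] c0Sum X :=
  (lpIncl X ∞ i).codRestrict (c0Sum X) fun x => by
    classical
    refine tendsto_const_nhds.congr' ?_
    filter_upwards [(Set.finite_singleton i).compl_mem_cofinite] with j hj
    have : j ≠ i := by simpa using hj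
    simp [lpIncl, this]

variable {X}

/-- The functionals on a sum `S` of the spaces `X i` (with embeddings `incl i`) whose restriction
to each `X i` lies in `D i` and is nonzero for only countably many `i`. -/
def sumFunctionals {S : Type u} [NormedAddCommGroup S] [NormedSpace ℝ S]
    (incl : ∀ i, X i →L[ℝ] S) (D : ∀ i, Set (StrongDual ℝ (X i))) : Set (StrongDual ℝ S) :=
  {φ | (∀ i, φ.comp (incl i) ∈ D i) ∧ {i | φ.comp (incl i) ≠ 0}.Countable}

end Sums

end

end ProjSkel

namespace ProjSkel

open FirstOrder FirstOrder.Language Cardinal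

/-! ### Closure properties of `H(θ)` -/

section Hereditary

/-! Part (a) becomes accessible once elementary substructures are eliminated. `GeneratesProjections
D` is equivalent to `SplitsAtClosed D`: some operation assigns to each finite set of points and
functionals a countable set, so that every countable set closed under it decomposes the space. From
projections to closed sets (`GeneratesProjections.splitsAtClosed`), the operation is the trace of a
Skolem hull in `H(θ)`. Conversely (`SplitsAtClosed.generatesProjections`), the closed countable sets
form a cofinal family stable under countable directed unions. A model `M` knows only `X` and `D`,
not the operation, but having such a family is first-order (`HSkeleton`). Hence `M` contains some
such family `C`, and the union of `C ∩ M` has the same points of `X` and functionals of `D` as `M`.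

For a sum, the operation combines the operations of the summands with countable norming sets for
points, but only at the countably many indices in the support of the given elements. In each
summand, norming makes the component in `X_M` no longer than the vector decomposed
(`norm_le_norm_add_of_norms`). The chosen components therefore assemble to an element of the sum;
this is `IsMonotoneSum.splitsAt`.

For the norm, a `c₀`-sum needs only functionals supported on one coordinate. In an `ℓ_p`-sum, a
norming functional is replaced by a finite combination of members of the `D i`, and its real
coefficients by rational ones; see `IsMonotoneSum.isOneNorming_of_smul_mem`.

Part (b) uses no models: adjoin to each index set a bottom index with projection `0`, and let the
countably supported choices of indices act coordinatewise (`IsMonotoneSum.hasProjectionalSkeleton`).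
-/

/-- The set `x` belongs to `H(θ)`. -/
def InH (θ : Cardinal.{u}) (x : ZFSet.{u}) : Prop :=
  Cardinal.mk (transitiveClosure x) < Cardinal.lift.{u + 1, u} θ

theorem mem_transitiveClosure_of_mem {x y : ZFSet.{u}} (h : y ∈ x) : y ∈ transitiveClosure x :=
  Relation.TransGen.single h

theorem transitiveClosure_mono_of_mem {x y : ZFSet.{u}} (h : y ∈ x) :
    transitiveClosure y ⊆ transitiveClosure x := fun _ hz => Relation.TransGen.tail hz h

theorem transitiveClosure_subset {x : ZFSet.{u}} {s : Set ZFSet.{u}}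
    (h : ∀ y ∈ x, y ∈ s ∧ transitiveClosure y ⊆ s) : transitiveClosure x ⊆ s := by
  intro z hz
  cases hz with
  | single h1 => exact (h z h1).1
  | tail h1 h2 => exact (h _ h2).2 h1

variable {θ : Cardinal.{u}}

theorem InH.of_subset_transitiveClosure {x y : ZFSet.{u}} (hx : InH θ x)
    (h : transitiveClosure y ⊆ transitiveClosure x) : InH θ y :=
  (Cardinal.mk_le_mk_of_subset h).trans_lt hx

theorem InH.mem {x y : ZFSet.{u}} (hx : InH θ x) (h : y ∈ x) : InH θ y :=
  hx.of_subset_transitiveClosure (transitiveClosure_mono_of_mem h)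

theorem InH.subset {x y : ZFSet.{u}} (hx : InH θ x) (h : y ⊆ x) : InH θ y :=
  hx.of_subset_transitiveClosure <| transitiveClosure_subset fun _ hz =>
    ⟨mem_transitiveClosure_of_mem (h hz), transitiveClosure_mono_of_mem (h hz)⟩

/-- By regularity, a union of countably many sets of size `< θ` has size `< θ`. This puts every
countable object built from a model back into `H(θ)`. -/
theorem InH.of_countable (hθ : θ.IsRegular) (hθ' : ℵ₀ < θ) {x : ZFSet.{u}}
    (hc : (x : Set ZFSet.{u}).Countable) (h : ∀ y ∈ x, InH θ y) : InH θ x := by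
  have hreg : (Cardinal.lift.{u + 1, u} θ).IsRegular := hθ.lift
  have hω : ℵ₀ < Cardinal.lift.{u + 1, u} θ := by simpa using hθ'
  have hsub : transitiveClosure x ⊆ ⋃ y : (x : Set ZFSet.{u}), insert y.1 (transitiveClosure y.1) :=
    transitiveClosure_subset fun y hy =>
      ⟨Set.mem_iUnion.2 ⟨⟨y, hy⟩, Set.mem_insert _ _⟩,
        fun z hz => Set.mem_iUnion.2 ⟨⟨y, hy⟩, Set.mem_insert_of_mem _ hz⟩⟩
  refine (Cardinal.mk_le_mk_of_subset hsub).trans_lt ((Cardinal.mk_iUnion_le_sum_mk).trans_lt ?_)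
  refine Cardinal.sum_lt_of_isRegular hreg ?_ fun y => ?_
  · exact (Cardinal.mk_le_aleph0_iff.2 hc.to_subtype).trans_lt hω
  · refine (Cardinal.mk_insert_le).trans_lt ?_
    exact Cardinal.add_lt_of_lt hreg.aleph0_le (h y.1 y.2) (Cardinal.one_lt_aleph0.trans hω)

theorem InH.pair (hθ : θ.IsRegular) (hθ' : ℵ₀ < θ) {x y : ZFSet.{u}} (hx : InH θ x)
    (hy : InH θ y) : InH θ (ZFSet.pair x y) := by
  have key : ∀ a b : ZFSet.{u}, InH θ a → InH θ b → InH θ ({a, b} : ZFSet.{u}) := fun a b ha hb => by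
    refine InH.of_countable hθ hθ' ?_ fun z hz => ?_
    · rw [ZFSet.coe_insert, ZFSet.coe_singleton]
      exact ((Set.finite_singleton b).insert a).countable
    · rcases ZFSet.mem_pair.1 hz with rfl | rfl <;> assumption
  refine key _ _ ?_ (key _ _ hx hy)
  have := key x x hx hx
  rwa [ZFSet.pair_eq_singleton] at this

theorem pair_left_mem_transitiveClosure (x y : ZFSet.{u}) :
    x ∈ transitiveClosure (ZFSet.pair x y) :=
  transitiveClosure_mono_of_mem (x := ZFSet.pair x y) (y := {x}) (by simp [ZFSet.pair])
    (mem_transitiveClosure_of_mem (by simp))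

theorem pair_right_mem_transitiveClosure (x y : ZFSet.{u}) :
    y ∈ transitiveClosure (ZFSet.pair x y) :=
  transitiveClosure_mono_of_mem (x := ZFSet.pair x y) (y := {x, y}) (by simp [ZFSet.pair])
    (mem_transitiveClosure_of_mem (by simp))

theorem transitiveClosure_mono {x y : ZFSet.{u}} (h : y ∈ transitiveClosure x) :
    transitiveClosure y ⊆ transitiveClosure x := fun _ hz => Relation.TransGen.trans hz h

theorem InH.of_mem_transitiveClosure {x y : ZFSet.{u}} (hx : InH θ x)
    (h : y ∈ transitiveClosure x) : InH θ y :=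
  hx.of_subset_transitiveClosure (transitiveClosure_mono h)

theorem InH.fst {x y : ZFSet.{u}} (h : InH θ (ZFSet.pair x y)) : InH θ x :=
  h.of_mem_transitiveClosure (pair_left_mem_transitiveClosure x y)

theorem InH.snd {x y : ZFSet.{u}} (h : InH θ (ZFSet.pair x y)) : InH θ y :=
  h.of_mem_transitiveClosure (pair_right_mem_transitiveClosure x y)

/-- The stage of the von Neumann hierarchy indexed by the rank of `x` is a transitive set containing
the elements of `x`. -/
theorem small_transitiveClosure (x : ZFSet.{u}) : Small.{u} (transitiveClosure x) := by
  have h : transitiveClosure x ⊆ ((ZFSet.vonNeumann (ZFSet.rank x) : ZFSet.{u}) : Set ZFSet.{u}) := by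
    refine transitiveClosure_subset fun y hy => ?_
    have hyx : y ∈ ZFSet.vonNeumann (ZFSet.rank x) := ZFSet.subset_vonNeumann_self x hy
    refine ⟨hyx, fun z hz => ?_⟩
    refine Relation.TransGen.head_induction_on hz (fun h => ?_) (fun h _ ih => ?_)
    · exact ZFSet.isTransitive_vonNeumann _ _ hyx h
    · exact ZFSet.isTransitive_vonNeumann _ _ ih h
  have : Small.{u} ((ZFSet.vonNeumann (ZFSet.rank x) : ZFSet.{u}) : Set ZFSet.{u}) :=
    ZFSet.small_coe _
  exact small_subset h

theorem exists_forall_inH (x : ZFSet.{u}) : ∃ θ₀ : Cardinal.{u}, ∀ θ, θ₀ ≤ θ → InH θ x := by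
  have := small_transitiveClosure x
  refine ⟨Order.succ (Cardinal.mk (Shrink.{u} (transitiveClosure x))), fun θ hθ => ?_⟩
  have h1 : Cardinal.mk (transitiveClosure x) =
      Cardinal.lift.{u + 1, u} (Cardinal.mk (Shrink.{u} (transitiveClosure x))) := by
    have := Cardinal.lift_mk_eq'.2 ⟨equivShrink.{u} (transitiveClosure x)⟩
    rw [Cardinal.lift_id'.{u, u+1}] at this
    exact this
  rw [InH, h1, Cardinal.lift_lt]
  exact (Order.lt_succ _).trans_le hθ

end Hereditary

/-! ### First-order definable predicates on `H(θ)` -/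

section FirstOrderPredicates

variable {θ : Cardinal.{u}}

/-- The predicate `P` on assignments is expressed by a first-order formula. -/
def FO (P : (ℕ → H θ) → Prop) : Prop :=
  ∃ φ : setLanguage.Formula ℕ, ∀ v, φ.Realize v ↔ P v

/-- Membership between elements of `H(θ)`. -/
def HMem (a b : H θ) : Prop := a.1 ∈ b.1

theorem FO.mem (i j : ℕ) : FO (θ := θ) fun v => HMem (v i) (v j) := by
  refine ⟨Relations.formula (L := setLanguage) (n := 2) SetRel.mem ![Term.var i, Term.var j],
    fun v => ?_⟩
  rfl

theorem FO.eq (i j : ℕ) : FO (θ := θ) fun v => v i = v j :=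
  ⟨Term.equal (Term.var i) (Term.var j), fun v => by simp [Formula.realize_equal]⟩

theorem FO.not {P : (ℕ → H θ) → Prop} (h : FO P) : FO fun v => ¬ P v := by
  obtain ⟨φ, hφ⟩ := h
  exact ⟨φ.not, fun v => by rw [Formula.realize_not, hφ]⟩

theorem FO.imp {P Q : (ℕ → H θ) → Prop} (hP : FO P) (hQ : FO Q) : FO fun v => P v → Q v := by
  obtain ⟨φ, hφ⟩ := hP
  obtain ⟨ψ, hψ⟩ := hQ
  exact ⟨φ.imp ψ, fun v => by rw [Formula.realize_imp, hφ, hψ]⟩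

theorem FO.and {P Q : (ℕ → H θ) → Prop} (hP : FO P) (hQ : FO Q) : FO fun v => P v ∧ Q v := by
  obtain ⟨φ, hφ⟩ := hP
  obtain ⟨ψ, hψ⟩ := hQ
  exact ⟨φ ⊓ ψ, fun v => by rw [Formula.realize_inf, hφ, hψ]⟩

theorem FO.or {P Q : (ℕ → H θ) → Prop} (hP : FO P) (hQ : FO Q) : FO fun v => P v ∨ Q v := by
  obtain ⟨φ, hφ⟩ := hP
  obtain ⟨ψ, hψ⟩ := hQ
  exact ⟨φ ⊔ ψ, fun v => by rw [Formula.realize_sup, hφ, hψ]⟩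

theorem FO.iff {P Q : (ℕ → H θ) → Prop} (hP : FO P) (hQ : FO Q) : FO fun v => (P v ↔ Q v) := by
  obtain ⟨φ, hφ⟩ := hP
  obtain ⟨ψ, hψ⟩ := hQ
  exact ⟨φ.iff ψ, fun v => by rw [Formula.realize_iff, hφ, hψ]⟩

/-- The sequence `a, v 0, v 1, …`. -/
def seqCons {α : Type*} (a : α) (v : ℕ → α) : ℕ → α
  | 0 => a
  | n + 1 => v n

/-- The formula `∃ a, φ(a, v 0, v 1, …)`. -/
noncomputable def exFormula (φ : setLanguage.Formula ℕ) : setLanguage.Formula ℕ :=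
  (Formula.relabel (seqCons (Sum.inr ()) Sum.inl) φ : setLanguage.Formula (ℕ ⊕ Unit)).iExs Unit

theorem realize_exFormula {N : Type*} [setLanguage.Structure N] (φ : setLanguage.Formula ℕ)
    (v : ℕ → N) :
    (exFormula φ).Realize v ↔ ∃ a, φ.Realize (seqCons a v) := by
  rw [exFormula, Formula.realize_iExs]
  simp only [Formula.realize_relabel]
  have key : ∀ i : Unit → N, Sum.elim v i ∘ seqCons (Sum.inr ()) Sum.inl = seqCons (i ()) v := by
    intro i
    funext n
    cases n <;> rfl
  constructor
  · rintro ⟨i, hi⟩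
    exact ⟨i (), by rwa [key] at hi⟩
  · rintro ⟨a, ha⟩
    exact ⟨fun _ => a, by rwa [key]⟩

/-- De Bruijn convention: the bound variable gets index `0` and the other variables shift up by one.
-/
theorem FO.ex {Q : H θ → (ℕ → H θ) → Prop} (h : FO fun v => Q (v 0) fun i => v (i + 1)) :
    FO fun v => ∃ a, Q a v := by
  obtain ⟨φ, hφ⟩ := h
  exact ⟨exFormula φ, fun v => by rw [realize_exFormula]; exact exists_congr fun a => hφ _⟩

theorem FO.all {Q : H θ → (ℕ → H θ) → Prop} (h : FO fun v => Q (v 0) fun i => v (i + 1)) :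
    FO fun v => ∀ a, Q a v := by
  obtain ⟨φ, hφ⟩ := FO.ex (Q := fun a v => ¬ Q a v) h.not
  exact ⟨φ.not, fun v => by rw [Formula.realize_not, hφ, not_exists_not]⟩

/-- An elementary substructure contains a witness for every true existential statement with
parameters in it. -/
theorem FO.exists_mem {Q : H θ → (ℕ → H θ) → Prop} (h : FO fun v => Q (v 0) fun i => v (i + 1))
    (M : setLanguage.ElementarySubstructure (H θ)) {v : ℕ → H θ} (hv : ∀ i, v i ∈ M)
    (hex : ∃ a, Q a v) : ∃ a ∈ M, Q a v := by
  obtain ⟨φ, hφ⟩ := h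
  let w : ℕ → M := fun i => ⟨v i, hv i⟩
  have hvw : v = M.subtype ∘ w := by funext i; rfl
  have h1 : (exFormula φ).Realize v := by rw [realize_exFormula]; exact (exists_congr fun a => hφ _).2 hex
  rw [hvw, M.subtype.map_formula, realize_exFormula] at h1
  obtain ⟨a, ha⟩ := h1
  refine ⟨a, a.2, ?_⟩
  rw [← M.subtype.map_formula, hφ] at ha
  exact ha

end FirstOrderPredicates

/-! ### Predicates used to describe normed spaces inside `H(θ)` -/

section Predicates

variable {θ : Cardinal.{u}}

theorem HMem.exists_of_mem {x : ZFSet.{u}} {a : H θ} (h : x ∈ a.1) : ∃ b : H θ, b.1 = x :=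
  ⟨⟨x, InH.mem (θ := θ) a.2 h⟩, rfl⟩

theorem H.ext {a b : H θ} (h : a.1 = b.1) : a = b := Subtype.ext h

theorem FO.congr {P Q : (ℕ → H θ) → Prop} (hP : FO P) (h : ∀ v, P v ↔ Q v) : FO Q := by
  obtain ⟨φ, hφ⟩ := hP
  exact ⟨φ, fun v => (hφ v).trans (h v)⟩

/-- `z` is the unordered pair `{a, b}`. -/
def HUPair (a b z : H θ) : Prop := ∀ w, HMem w z ↔ w = a ∨ w = b

theorem hUPair_iff {a b z : H θ} : HUPair a b z ↔ z.1 = {a.1, b.1} := by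
  constructor
  · intro h
    ext w
    rw [ZFSet.mem_pair]
    constructor
    · intro hw
      obtain ⟨w, rfl⟩ := HMem.exists_of_mem hw
      exact ((h w).1 hw).imp (congrArg _) (congrArg _)
    · rintro (rfl | rfl)
      · exact (h a).2 (Or.inl rfl)
      · exact (h b).2 (Or.inr rfl)
  · intro h w
    rw [HMem, h, ZFSet.mem_pair]
    exact or_congr ⟨H.ext, congrArg _⟩ ⟨H.ext, congrArg _⟩

/-- `p` is the ordered pair `(a, b)`. -/
def HPair (a b p : H θ) : Prop := p.1 = ZFSet.pair a.1 b.1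

/-- Quantifiers restricted to `H(θ)` suffice because `H(θ)` is transitive: every element of `p` is
itself in `H(θ)`. -/
theorem hPair_iff {a b p : H θ} : HPair a b p ↔
    (∀ z, HMem z p → HUPair a a z ∨ HUPair a b z) ∧ (∃ z, HMem z p ∧ HUPair a a z) ∧
      ∃ z, HMem z p ∧ HUPair a b z := by
  have key : ∀ z : ZFSet.{u}, z ∈ ZFSet.pair a.1 b.1 ↔ z = {a.1, a.1} ∨ z = {a.1, b.1} := by
    intro z
    rw [ZFSet.pair_eq_singleton, ZFSet.pair, ZFSet.mem_pair]
  simp only [hUPair_iff, HMem, HPair]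
  constructor
  · intro h
    rw [h]
    refine ⟨fun z hz => (key _).1 hz, ?_, ?_⟩
    · have hz := (key _).2 (Or.inl rfl)
      rw [← h] at hz
      obtain ⟨z, hz'⟩ := HMem.exists_of_mem hz
      exact ⟨z, by rw [← h, hz']; exact hz, hz'⟩
    · have hz := (key _).2 (Or.inr rfl)
      rw [← h] at hz
      obtain ⟨z, hz'⟩ := HMem.exists_of_mem hz
      exact ⟨z, by rw [← h, hz']; exact hz, hz'⟩
  · rintro ⟨h1, ⟨z, hz, hz'⟩, ⟨w, hw, hw'⟩⟩
    ext y
    rw [key]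
    constructor
    · intro hy
      obtain ⟨y, rfl⟩ := HMem.exists_of_mem hy
      exact h1 y hy
    · rintro (rfl | rfl)
      · rwa [← hz']
      · rwa [← hw']

/-- `(a, b) ∈ f`. -/
def HApp (f a b : H θ) : Prop := ZFSet.pair a.1 b.1 ∈ f.1

theorem hApp_iff {f a b : H θ} : HApp f a b ↔ ∃ p, HPair a b p ∧ HMem p f := by
  constructor
  · intro h
    obtain ⟨p, hp⟩ := HMem.exists_of_mem h
    exact ⟨p, hp, by rw [HMem, hp]; exact h⟩
  · rintro ⟨p, hp, h⟩
    rw [HMem, hp] at h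
    exact h

/-- `((a, b), c) ∈ f`. -/
def HApp₂ (f a b c : H θ) : Prop := ZFSet.pair (ZFSet.pair a.1 b.1) c.1 ∈ f.1

theorem hApp₂_iff {f a b c : H θ} : HApp₂ f a b c ↔ ∃ p, HPair a b p ∧ HApp f p c := by
  constructor
  · intro h
    refine ⟨⟨ZFSet.pair a.1 b.1, InH.fst (InH.mem (θ := θ) f.2 h)⟩, rfl, h⟩
  · rintro ⟨p, hp, h⟩
    rw [HApp, hp] at h
    exact h

theorem FO.uPair (i j k : ℕ) : FO (θ := θ) fun v => HUPair (v i) (v j) (v k) :=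
  FO.all <| (FO.mem _ _).iff ((FO.eq _ _).or (FO.eq _ _))

theorem FO.pair (i j k : ℕ) : FO (θ := θ) fun v => HPair (v i) (v j) (v k) := by
  refine FO.congr ?_ fun v => hPair_iff.symm
  refine FO.and (FO.all ?_) (FO.and (FO.ex ?_) (FO.ex ?_))
  · exact (FO.mem _ _).imp ((FO.uPair _ _ _).or (FO.uPair _ _ _))
  · exact (FO.mem _ _).and (FO.uPair _ _ _)
  · exact (FO.mem _ _).and (FO.uPair _ _ _)

theorem FO.app (i j k : ℕ) : FO (θ := θ) fun v => HApp (v i) (v j) (v k) := by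
  refine FO.congr ?_ fun v => hApp_iff.symm
  exact FO.ex <| (FO.pair _ _ _).and (FO.mem _ _)

theorem FO.app₂ (i j k l : ℕ) : FO (θ := θ) fun v => HApp₂ (v i) (v j) (v k) (v l) := by
  refine FO.congr ?_ fun v => hApp₂_iff.symm
  exact FO.ex <| (FO.pair _ _ _).and (FO.app _ _ _)

/-- `g` is a partial function, and every set that contains `a` and is closed under `g` contains
`b`. -/
def HGenerates (a g b : H θ) : Prop :=
  (∀ x y y', HApp g x y → HApp g x y' → y = y') ∧
    ∀ B, HMem a B → (∀ x y, HMem x B → HApp g x y → HMem y B) → ∀ x, HMem x b → HMem x B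

theorem FO.generates (i j k : ℕ) : FO (θ := θ) fun v => HGenerates (v i) (v j) (v k) := by
  unfold HGenerates
  refine FO.and (FO.all <| FO.all <| FO.all ?_) (FO.all ?_)
  · exact (FO.app _ _ _).imp <| (FO.app _ _ _).imp (FO.eq _ _)
  · refine (FO.mem _ _).imp <| FO.imp (FO.all <| FO.all ?_) (FO.all ?_)
    · exact (FO.mem _ _).imp <| (FO.app _ _ _).imp (FO.mem _ _)
    · exact (FO.mem _ _).imp (FO.mem _ _)

/-- `b` is contained in the orbit of a point under a partial function. -/
def HCountable (b : H θ) : Prop := ∃ a g, HGenerates a g b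

theorem FO.hCountable (i : ℕ) : FO (θ := θ) fun v => HCountable (v i) :=
  FO.ex <| FO.ex <| FO.generates _ _ _

/-- The family `F` is nonempty and directed by inclusion. -/
def HDirected (F : H θ) : Prop :=
  (∃ b, HMem b F) ∧ ∀ b b', HMem b F → HMem b' F →
    ∃ b'', HMem b'' F ∧ ∀ z, HMem z b ∨ HMem z b' → HMem z b''

theorem FO.directed (i : ℕ) : FO (θ := θ) fun v => HDirected (v i) := by
  unfold HDirected
  refine FO.and (FO.ex (FO.mem _ _)) (FO.all <| FO.all ?_)
  refine (FO.mem _ _).imp <| (FO.mem _ _).imp <| FO.ex <| (FO.mem _ _).and <| FO.all ?_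
  exact FO.imp ((FO.mem _ _).or (FO.mem _ _)) (FO.mem _ _)

/-- `‖y - a‖ < ‖w‖`, in terms of the graphs of addition and norm. -/
def HNear (add nrm y a w : H θ) : Prop :=
  ∃ h r r', HApp₂ add h a y ∧ HApp nrm h r ∧ HApp nrm w r' ∧
    (∀ q, HMem q r → HMem q r') ∧ ¬ r = r'

theorem FO.near (i j k l m : ℕ) :
    FO (θ := θ) fun v => HNear (v i) (v j) (v k) (v l) (v m) := by
  unfold HNear
  refine FO.ex <| FO.ex <| FO.ex ?_
  refine (FO.app₂ _ _ _ _).and <| (FO.app _ _ _).and <| (FO.app _ _ _).and <| FO.and ?_ ?_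
  · exact FO.all <| (FO.mem _ _).imp (FO.mem _ _)
  · exact (FO.eq _ _).not

/-- `y` is in the norm closure of the points in `A`. -/
def HClosure (pts add nrm A y : H θ) : Prop :=
  HMem y pts ∧ (∃ a, HMem a A ∧ HMem a pts) ∧ ∀ w, HMem w pts → ¬ HApp₂ add w w w →
    ∃ a, (HMem a A ∧ HMem a pts) ∧ HNear add nrm y a w

theorem FO.hClosure (i j k l m : ℕ) :
    FO (θ := θ) fun v => HClosure (v i) (v j) (v k) (v l) (v m) := by
  unfold HClosure
  refine (FO.mem _ _).and <| (FO.ex <| (FO.mem _ _).and (FO.mem _ _)).and <| FO.all ?_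
  refine (FO.mem _ _).imp <| (FO.app₂ _ _ _ _).not.imp <| FO.ex ?_
  exact ((FO.mem _ _).and (FO.mem _ _)).and (FO.near _ _ _ _ _)

/-- Every functional in `d ∩ A` takes the same value at `x` and at `y`. -/
def HAgree (d A x y : H θ) : Prop :=
  ∀ f, HMem f d → HMem f A → ∃ r, HApp f x r ∧ HApp f y r

theorem FO.agree (i j k l : ℕ) : FO (θ := θ) fun v => HAgree (v i) (v j) (v k) (v l) := by
  unfold HAgree
  exact FO.all <| (FO.mem _ _).imp <| (FO.mem _ _).imp <| FO.ex <|
    (FO.app _ _ _).and (FO.app _ _ _)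

/-- The closure of the points in `A` is a subspace complementing the annihilator of `d ∩ A`. -/
def HSplits (pts add smul nrm d A : H θ) : Prop :=
  (∀ x, HMem x pts → ∃ y, HClosure pts add nrm A y ∧ HAgree d A x y) ∧
  (∀ y z, HClosure pts add nrm A y → HApp₂ add z z z → HAgree d A y z → y = z) ∧
  (∀ y y' z, HClosure pts add nrm A y → HClosure pts add nrm A y' → HApp₂ add y y' z →
    HClosure pts add nrm A z) ∧
  ∀ y t z, HClosure pts add nrm A y → HApp₂ smul t y z → HClosure pts add nrm A z

theorem FO.splits (i j k l m n : ℕ) :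
    FO (θ := θ) fun v => HSplits (v i) (v j) (v k) (v l) (v m) (v n) := by
  unfold HSplits
  refine FO.and (FO.all ?_) (FO.and (FO.all <| FO.all ?_)
    (FO.and (FO.all <| FO.all <| FO.all ?_) (FO.all <| FO.all <| FO.all ?_)))
  · exact (FO.mem _ _).imp <| FO.ex <| (FO.hClosure _ _ _ _ _).and (FO.agree _ _ _ _)
  · exact (FO.hClosure _ _ _ _ _).imp <| (FO.app₂ _ _ _ _).imp <| (FO.agree _ _ _ _).imp
      (FO.eq _ _)
  · exact (FO.hClosure _ _ _ _ _).imp <| (FO.hClosure _ _ _ _ _).imp <|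
      (FO.app₂ _ _ _ _).imp (FO.hClosure _ _ _ _ _)
  · exact (FO.hClosure _ _ _ _ _).imp <| (FO.app₂ _ _ _ _).imp (FO.hClosure _ _ _ _ _)

/-- `C` is a directed family of countable sets covering the points and `d`, such that the union of
each countable directed subfamily splits the space. -/
def HSkeleton (pts add smul nrm d C : H θ) : Prop :=
  (∀ b, HMem b C → HCountable b) ∧
  (∀ x, HMem x pts ∨ HMem x d → ∃ b, HMem b C ∧ HMem x b) ∧ HDirected C ∧
  ∀ F A, (∀ b, HMem b F → HMem b C) → HCountable F → HDirected F →
    (∀ z, HMem z A ↔ ∃ b, HMem b F ∧ HMem z b) → HSplits pts add smul nrm d A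

theorem FO.skeleton (i j k l m n : ℕ) :
    FO (θ := θ) fun v => HSkeleton (v i) (v j) (v k) (v l) (v m) (v n) := by
  unfold HSkeleton
  refine FO.and (FO.all ?_) (FO.and (FO.all ?_) (FO.and (FO.directed _) (FO.all <| FO.all ?_)))
  · exact (FO.mem _ _).imp (FO.hCountable _)
  · exact FO.imp ((FO.mem _ _).or (FO.mem _ _)) <| FO.ex <| (FO.mem _ _).and (FO.mem _ _)
  · refine FO.imp (FO.all <| (FO.mem _ _).imp (FO.mem _ _)) <| (FO.hCountable _).imp <|
      (FO.directed _).imp <| FO.imp (FO.all <| (FO.mem _ _).iff (FO.ex ?_)) (FO.splits _ _ _ _ _ _)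
    exact (FO.mem _ _).and (FO.mem _ _)

/-! ### Countability -/

/-- The orbit of `a` is countable, hence a member of `H(θ)`, hence one of the closed sets over which
`HGenerates` quantifies. -/
theorem HGenerates.countable (hθ : θ.IsRegular) (hθ' : ℵ₀ < θ) {a g b : H θ}
    (h : HGenerates a g b) : (b.1 : Set ZFSet.{u}).Countable := by
  classical
  let f : H θ → H θ := fun x => if hx : ∃ y, HApp g x y then hx.choose else x
  let s : ℕ → ZFSet.{u} := fun n => (f^[n] a).1
  have hs : InH θ (ZFSet.range s) := by
    refine InH.of_countable hθ hθ' ?_ fun y hy => ?_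
    · rw [ZFSet.coe_range]; exact Set.countable_range s
    · obtain ⟨n, rfl⟩ := ZFSet.mem_range.1 hy
      exact (f^[n] a).2
  have hsub := h.2 ⟨ZFSet.range s, hs⟩ (ZFSet.mem_range.2 ⟨0, rfl⟩) ?_
  · refine (Set.countable_range s).mono fun x hx => ?_
    obtain ⟨x, rfl⟩ := HMem.exists_of_mem hx
    exact ZFSet.mem_range.1 (hsub x hx)
  · intro x y hx hxy
    obtain ⟨n, hn⟩ := ZFSet.mem_range.1 hx
    have hn' : f^[n] a = x := H.ext hn
    refine ZFSet.mem_range.2 ⟨n + 1, ?_⟩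
    have hex : ∃ y, HApp g x y := ⟨y, hxy⟩
    change (f^[n + 1] a).1 = y.1
    rw [Function.iterate_succ_apply', hn']
    simp only [f, dif_pos hex]
    rw [h.1 x _ _ hex.choose_spec hxy]

/-- Transport the successor map from `ℕ`, or the cyclic shift from `Fin (n + 1)` when `α` is finite.
-/
theorem exists_generating_map (α : Type*) [Countable α] [Nonempty α] :
    ∃ (a : α) (g : α → α), ∀ B : Set α, a ∈ B → (∀ x ∈ B, g x ∈ B) → ∀ x, x ∈ B := by
  rcases finite_or_infinite α with h | h
  · obtain ⟨n, ⟨e⟩⟩ := Finite.exists_equiv_fin α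
    cases n with
    | zero => exact (e (Classical.arbitrary α)).elim0
    | succ n =>
      refine ⟨e.symm 0, fun x => e.symm (e x + 1), fun B h0 hB x => ?_⟩
      have key : ∀ k : Fin (n + 1), e.symm k ∈ B := by
        intro k
        induction k using Fin.induction with
        | zero => exact h0
        | succ i hi => simpa [Fin.coeSucc_eq_succ] using hB _ hi
      simpa using key (e x)
  · obtain ⟨e⟩ := nonempty_equiv_of_countable (α := α) (β := ℕ)
    refine ⟨e.symm 0, fun x => e.symm (e x + 1), fun B h0 hB x => ?_⟩
    have key : ∀ k, e.symm k ∈ B := by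
      intro k
      induction k with
      | zero => exact h0
      | succ i hi => simpa using hB _ hi
    simpa using key (e x)

theorem hCountable_of_countable (hθ : θ.IsRegular) (hθ' : ℵ₀ < θ) {b : H θ}
    (h : (b.1 : Set ZFSet.{u}).Countable) : HCountable b := by
  rcases (b.1 : Set ZFSet.{u}).eq_empty_or_nonempty with h0 | h0
  · have : InH θ ∅ := InH.subset b.2 (ZFSet.empty_subset _)
    refine ⟨⟨∅, this⟩, ⟨∅, this⟩, fun x y y' hx => absurd hx (ZFSet.notMem_empty _),
      fun B _ _ x hx => ?_⟩
    have : x.1 ∈ (b.1 : Set ZFSet.{u}) := hx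
    rw [h0] at this
    exact this.elim
  · have := h.to_subtype
    have := h0.to_subtype
    obtain ⟨a, g, hg⟩ := exists_generating_map (b.1 : Set ZFSet.{u})
    have : Small.{u} (b.1 : Set ZFSet.{u}) := ZFSet.small_coe _
    let G : ZFSet.{u} := ZFSet.range fun x : (b.1 : Set ZFSet.{u}) => ZFSet.pair x.1 (g x).1
    have hb : ∀ x : (b.1 : Set ZFSet.{u}), InH θ x.1 := fun x => InH.mem b.2 x.2
    have hG : InH θ G := by
      refine InH.of_countable hθ hθ' ?_ fun y hy => ?_
      · rw [ZFSet.coe_range]; exact Set.countable_range _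
      · obtain ⟨x, rfl⟩ := ZFSet.mem_range.1 hy
        exact InH.pair hθ hθ' (hb _) (hb _)
    refine ⟨⟨a.1, hb a⟩, ⟨G, hG⟩, fun x y y' h1 h2 => ?_, fun B ha hB x hx => ?_⟩
    · obtain ⟨z, hz⟩ := ZFSet.mem_range.1 h1
      obtain ⟨z', hz'⟩ := ZFSet.mem_range.1 h2
      rw [ZFSet.pair_inj] at hz hz'
      have : z = z' := Subtype.ext (hz.1.trans hz'.1.symm)
      subst this
      exact H.ext (hz.2.symm.trans hz'.2)
    · exact hg {x | x.1 ∈ B.1} ha (fun x hx => hB ⟨x.1, hb x⟩ ⟨(g x).1, hb _⟩ hx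
        (ZFSet.mem_range.2 ⟨x, rfl⟩)) ⟨x.1, hx⟩

/-- The set `b` of all elements of a countable elementary substructure that satisfy `p`. -/
theorem exists_setOf_mem_model (hθ : θ.IsRegular) (hθ' : ℵ₀ < θ)
    {M : setLanguage.ElementarySubstructure (H θ)} (hM : (M : Set (H θ)).Countable)
    (p : H θ → Prop) : ∃ b : H θ, ∀ x, HMem x b ↔ x ∈ M ∧ p x := by
  have : Countable {x : H θ // x ∈ M ∧ p x} :=
    (hM.mono (s₁ := {x | x ∈ M ∧ p x}) fun x hx => hx.1).to_subtype
  refine ⟨⟨ZFSet.range fun x : {x : H θ // x ∈ M ∧ p x} => x.1.1,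
    InH.of_countable hθ hθ' ?_ fun y hy => ?_⟩, fun x => ?_⟩
  · rw [ZFSet.coe_range]; exact Set.countable_range _
  · obtain ⟨x, rfl⟩ := ZFSet.mem_range.1 hy
    exact x.1.2
  · refine ZFSet.mem_range.trans ⟨?_, fun h => ⟨⟨x, h⟩, rfl⟩⟩
    rintro ⟨y, hy⟩
    rw [← H.ext hy]
    exact y.2

/-- A set in a countable elementary substructure that is countable in `H(θ)` is a subset of it. -/
theorem HCountable.subset (hθ : θ.IsRegular) (hθ' : ℵ₀ < θ)
    {M : setLanguage.ElementarySubstructure (H θ)} (hM : (M : Set (H θ)).Countable) {b : H θ}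
    (hb : HCountable b) (hbM : b ∈ M) {x : H θ} (hx : HMem x b) : x ∈ M := by
  obtain ⟨a, haM, g, hg⟩ := (FO.ex (FO.generates 1 0 2)).exists_mem
    (Q := fun a v => ∃ g, HGenerates a g (v 0)) M (v := fun _ => b) (fun _ => hbM) hb
  obtain ⟨g, hgM, hg⟩ := (FO.generates 1 0 2).exists_mem
    (Q := fun g v => HGenerates (v 0) g (v 1)) M (v := seqCons a fun _ => b)
    (fun i => by cases i <;> assumption) ⟨g, hg⟩
  change HGenerates a g b at hg
  -- `B` is `M` itself, a member of `H(θ)` as `M` is countable. It is closed under `g` because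
  -- values of a function in `M` at arguments in `M` are definable.
  obtain ⟨B, hB⟩ := exists_setOf_mem_model hθ hθ' hM fun _ => True
  simp only [and_true] at hB
  rw [← hB]
  refine hg.2 B ((hB a).2 haM) (fun y z hy hyz => (hB z).2 ?_) x hx
  obtain ⟨z', hz'M, hz'⟩ := (FO.app 1 2 0).exists_mem
    (Q := fun z v => HApp (v 0) (v 1) z) M (v := seqCons g fun _ => y)
    (fun i => by cases i; exacts [hgM, (hB y).1 hy]) ⟨z, hyz⟩
  rwa [hg.1 y z z' hyz hz']

/-- The components of an ordered pair in an elementary substructure belong to it. -/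
theorem pair_mem_model {M : setLanguage.ElementarySubstructure (H θ)} {x y : ZFSet.{u}}
    (h : MemModel M (ZFSet.pair x y)) : MemModel M x ∧ MemModel M y := by
  obtain ⟨p, hpM, hp⟩ := h
  have hp' : InH θ (ZFSet.pair x y) := hp ▸ p.2
  obtain ⟨a, haM, b, hab⟩ := (FO.ex (FO.pair 1 0 2)).exists_mem
    (Q := fun a v => ∃ b, HPair a b (v 0)) M (v := fun _ => p) (fun _ => hpM)
    ⟨⟨x, hp'.fst⟩, ⟨y, hp'.snd⟩, hp⟩
  obtain ⟨b, hbM, hab⟩ := (FO.pair 1 0 2).exists_mem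
    (Q := fun b v => HPair (v 0) b (v 1)) M (v := seqCons a fun _ => p)
    (fun i => by cases i <;> assumption) ⟨b, hab⟩
  have hab' : p.1 = ZFSet.pair a.1 b.1 := hab
  rw [hp, ZFSet.pair_inj] at hab'
  exact ⟨⟨a, haM, hab'.1.symm⟩, ⟨b, hbM, hab'.2.symm⟩⟩

end Predicates

/-! ### Splitting along closed countable sets of points and functionals -/

section SplitsAt

variable {X : Type*} [NormedAddCommGroup X] [NormedSpace ℝ X]

/-- The points in `A` and the functionals in `D ∩ A` decompose the space: the closure of the points
is a subspace complementing the annihilator of the functionals. -/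
def SplitsAt (D : Set (StrongDual ℝ X)) (A : Set (X ⊕ StrongDual ℝ X)) : Prop :=
  ∃ Y : Submodule ℝ X, (Y : Set X) = closure {x | Sum.inl x ∈ A} ∧
    IsCompl Y (leftAnnihilator {φ ∈ D | Sum.inr φ ∈ A})

/-- `A` is closed under the finitary operation `c`. -/
def IsClosedUnder {α : Type*} (c : Finset α → Set α) (A : Set α) : Prop :=
  ∀ t : Finset α, (t : Set α) ⊆ A → c t ⊆ A

/-- `D` splits the space along all countable sets closed under some countably-valued finitary
operation. -/
def SplitsAtClosed (D : Set (StrongDual ℝ X)) : Prop :=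
  ∃ c : Finset (X ⊕ StrongDual ℝ X) → Set (X ⊕ StrongDual ℝ X), (∀ t, (c t).Countable) ∧
    ∀ A, A.Countable → IsClosedUnder c A → SplitsAt D A

/-- Iterate `ω` times: a finite subset of the union already appears at a finite stage, and a
countable set has only countably many finite subsets. -/
theorem exists_isClosedUnder_superset {α : Type*} {c : Finset α → Set α}
    (hc : ∀ t, (c t).Countable) {A : Set α} (hA : A.Countable) :
    ∃ B, A ⊆ B ∧ B.Countable ∧ IsClosedUnder c B := by
  let step : Set α → Set α := fun B => B ∪ ⋃ t : {t : Finset α // (t : Set α) ⊆ B}, c t.1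
  have hstep : ∀ B, B.Countable → (step B).Countable := by
    intro B hB
    have : Countable {t : Finset α // (t : Set α) ⊆ B} := by
      have h := (Set.countable_ofPred_finite_subset hB).preimage_of_injOn
        (f := fun t : Finset α => (t : Set α)) Finset.coe_injective.injOn
      exact (h.mono (s₁ := {t : Finset α | (t : Set α) ⊆ B})
        fun t ht => And.intro t.finite_toSet ht).to_subtype
    exact hB.union (Set.countable_iUnion fun t => hc _)
  let s : ℕ → Set α := fun n => step^[n] A
  have hs : ∀ n, s (n + 1) = step (s n) := fun n => Function.iterate_succ_apply' _ _ _
  have hmono : Monotone s := monotone_nat_of_le_succ fun n => by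
    rw [hs]; exact Set.subset_union_left
  refine ⟨⋃ n, s n, Set.subset_iUnion s 0, Set.countable_iUnion fun n => ?_, fun t ht => ?_⟩
  · induction n with
    | zero => exact hA
    | succ n ih => rw [hs]; exact hstep _ ih
  · obtain ⟨n, hn⟩ : ∃ n, (t : Set α) ⊆ s n := by
      exact (hmono.directed_le).exists_mem_subset_of_finset_subset_biUnion (s := t) (f := s) ht
    refine Set.Subset.trans ?_ (Set.subset_iUnion s (n + 1))
    rw [hs]
    exact (Set.subset_iUnion (fun t : {t : Finset α // (t : Set α) ⊆ s n} => c t.1)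
      ⟨t, hn⟩).trans Set.subset_union_right

theorem IsClosedUnder.sUnion {α : Type*} {c : Finset α → Set α} {F : Set (Set α)}
    (hF : F.Nonempty) (hd : DirectedOn (· ⊆ ·) F) (h : ∀ A ∈ F, IsClosedUnder c A) :
    IsClosedUnder c (⋃₀ F) := by
  intro t ht
  obtain ⟨A, hA, htA⟩ := hd.exists_mem_subset_of_finset_subset_biUnion hF
    (f := id) (s := t) (by simpa [Set.sUnion_eq_biUnion] using ht)
  exact (h A hA t htA).trans (Set.subset_sUnion_of_mem hA)

end SplitsAt

/-! ### Codes -/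

section Codes

theorem natCode_injective : Function.Injective natCode.{u} := fun m n h => by
  have := Ordinal.toZFSet_injective h
  exact_mod_cast this

theorem intCode_injective : Function.Injective intCode.{u} := fun k l h => by
  rw [intCode, intCode, ZFSet.pair_inj] at h
  have h1 := natCode_injective h.1
  have h2 := natCode_injective h.2
  omega

theorem ratCode_injective : Function.Injective ratCode.{u} := fun p q h => by
  rw [ratCode, ratCode, ZFSet.pair_inj] at h
  exact Rat.ext (intCode_injective h.1) (natCode_injective h.2)

theorem mem_realCode {t : ℝ} {z : ZFSet.{u}} :
    z ∈ realCode t ↔ ∃ q : ℚ, (q : ℝ) < t ∧ ratCode q = z := by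
  rw [realCode, ZFSet.mem_range]
  exact ⟨fun ⟨q, hq⟩ => ⟨q.1, q.2, hq⟩, fun ⟨q, hq, h⟩ => ⟨⟨q, hq⟩, h⟩⟩

theorem ratCode_mem_realCode {t : ℝ} {q : ℚ} : ratCode.{u} q ∈ realCode t ↔ (q : ℝ) < t := by
  rw [mem_realCode]
  exact ⟨fun ⟨p, hp, h⟩ => ratCode_injective h ▸ hp, fun h => ⟨q, h, rfl⟩⟩

theorem realCode_subset_realCode {s t : ℝ} :
    realCode.{u} s ⊆ realCode t ↔ s ≤ t := by
  constructor
  · intro h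
    by_contra! hlt
    obtain ⟨q, hq1, hq2⟩ := exists_rat_btwn hlt
    exact absurd (ratCode_mem_realCode.1 (h (ratCode_mem_realCode.2 hq2))) hq1.not_gt
  · intro h z hz
    obtain ⟨q, hq, rfl⟩ := mem_realCode.1 hz
    exact ratCode_mem_realCode.2 (hq.trans_le h)

theorem realCode_injective : Function.Injective realCode.{u} := fun _ _ h =>
  le_antisymm (realCode_subset_realCode.1 h.subset) (realCode_subset_realCode.1 h.symm.subset)

variable {X : Type u} [NormedAddCommGroup X] [NormedSpace ℝ X] (e : X ↪ ZFSet.{u})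

theorem functionalCode_injective : Function.Injective (functionalCode e) := by
  intro φ ψ h
  ext x
  have hx : ZFSet.pair (e x) (realCode (φ x)) ∈ functionalCode e ψ := by
    rw [← h]; exact ZFSet.mem_range.2 ⟨x, rfl⟩
  obtain ⟨y, hy⟩ := ZFSet.mem_range.1 hx
  rw [ZFSet.pair_inj] at hy
  rw [← e.injective hy.1, realCode_injective hy.2, e.injective hy.1]

/-- The set coding a point or a functional. -/
noncomputable def elementCode : X ⊕ StrongDual ℝ X → ZFSet.{u} := Sum.elim e (functionalCode e)

/-- `elementCode e` need not be injective, since a point and a functional may share a code, but it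
is injective on each of the two summands. -/
theorem countable_preimage_elementCode {s : Set ZFSet.{u}} (hs : s.Countable) :
    (elementCode e ⁻¹' s).Countable := by
  have h : elementCode e ⁻¹' s =
      Sum.inl '' (e ⁻¹' s) ∪ Sum.inr '' (functionalCode e ⁻¹' s) := by
    ext (x | φ) <;> simp [elementCode]
  rw [h]
  exact ((hs.preimage_of_injOn e.injective.injOn).image _).union
    ((hs.preimage_of_injOn (functionalCode_injective e).injOn).image _)

end Codes

/-! ### Meaning of the coded predicates -/

section Meaning

variable {X : Type u} [NormedAddCommGroup X] [NormedSpace ℝ X] {θ : Cardinal.{u}}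

/-- The elements `pts`, `add`, `smul`, `nrm`, `d` of `H(θ)` are the codes of the set of points, of
the graphs of the operations of `X` and of the set of functionals `D`. -/
structure IsCode (e : X ↪ ZFSet.{u}) (D : Set (StrongDual ℝ X)) (pts add smul nrm d : H θ) :
    Prop where
  pts_eq : pts.1 = ZFSet.range fun x : X => e x
  add_eq : add.1 =
    ZFSet.range fun z : X × X => ZFSet.pair (ZFSet.pair (e z.1) (e z.2)) (e (z.1 + z.2))
  smul_eq : smul.1 =
    ZFSet.range fun z : ℝ × X => ZFSet.pair (ZFSet.pair (realCode z.1) (e z.2)) (e (z.1 • z.2))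
  nrm_eq : nrm.1 = ZFSet.range fun x : X => ZFSet.pair (e x) (realCode ‖x‖)
  d_eq : d.1 = functionalSetCode e D

namespace IsCode

variable {e : X ↪ ZFSet.{u}} {D : Set (StrongDual ℝ X)} {pts add smul nrm d : H θ}
  (h : IsCode e D pts add smul nrm d)

include h

theorem mem_pts {a : H θ} : HMem a pts ↔ ∃ x, a.1 = e x := by
  rw [HMem, h.pts_eq, ZFSet.mem_range]
  simp only [eq_comm]

theorem inH_point (x : X) : InH θ (e x) :=
  InH.mem pts.2 (by rw [h.pts_eq]; exact ZFSet.mem_range.2 ⟨x, rfl⟩)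

/-- The point `x` as an element of `H(θ)`. -/
def point (x : X) : H θ := ⟨e x, h.inH_point x⟩

theorem point_mem (x : X) : HMem (h.point x) pts := h.mem_pts.2 ⟨x, rfl⟩

theorem forall_mem_pts {p : H θ → Prop} : (∀ a, HMem a pts → p a) ↔ ∀ x, p (h.point x) := by
  constructor
  · exact fun hp x => hp _ (h.point_mem x)
  · intro hp a ha
    obtain ⟨x, hx⟩ := h.mem_pts.1 ha
    rw [H.ext (b := h.point x) hx]
    exact hp x

theorem exists_mem_pts {p q : H θ → Prop} :
    (∃ a, (q a ∧ HMem a pts) ∧ p a) ↔ ∃ x, q (h.point x) ∧ p (h.point x) := by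
  constructor
  · rintro ⟨a, ⟨hq, ha⟩, hp⟩
    obtain ⟨x, hx⟩ := h.mem_pts.1 ha
    rw [H.ext (b := h.point x) hx] at hp hq
    exact ⟨x, hq, hp⟩
  · rintro ⟨x, hq, hp⟩
    exact ⟨_, ⟨hq, h.point_mem x⟩, hp⟩

theorem app₂_add {a b c : H θ} :
    HApp₂ add a b c ↔ ∃ x y, a = h.point x ∧ b = h.point y ∧ c = h.point (x + y) := by
  rw [HApp₂, h.add_eq, ZFSet.mem_range]
  simp only [ZFSet.pair_inj, Prod.exists]
  refine exists_congr fun x => exists_congr fun y => ?_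
  constructor
  · rintro ⟨⟨h1, h2⟩, h3⟩
    exact ⟨H.ext h1.symm, H.ext h2.symm, H.ext h3.symm⟩
  · rintro ⟨rfl, rfl, rfl⟩
    exact ⟨⟨rfl, rfl⟩, rfl⟩

theorem point_injective : Function.Injective h.point := fun _ _ hxy =>
  e.injective (congrArg Subtype.val hxy)

theorem app₂_add_point {x y z : X} :
    HApp₂ add (h.point x) (h.point y) (h.point z) ↔ x + y = z := by
  rw [h.app₂_add]
  constructor
  · rintro ⟨x', y', h1, h2, h3⟩
    rw [h.point_injective h1, h.point_injective h2, h.point_injective h3]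
  · rintro rfl
    exact ⟨x, y, rfl, rfl, rfl⟩

theorem app_nrm_point {x : X} {r : H θ} : HApp nrm (h.point x) r ↔ r.1 = realCode ‖x‖ := by
  rw [HApp, h.nrm_eq, ZFSet.mem_range]
  simp only [ZFSet.pair_inj]
  constructor
  · rintro ⟨y, h1, h2⟩
    rw [← h2, e.injective h1]
  · exact fun hr => ⟨x, rfl, hr.symm⟩

theorem inH_norm (x : X) : InH θ (realCode ‖x‖) := by
  have : ZFSet.pair (e x) (realCode ‖x‖) ∈ nrm.1 := by
    rw [h.nrm_eq]; exact ZFSet.mem_range.2 ⟨x, rfl⟩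
  exact (InH.mem nrm.2 this).snd

theorem near_point {x a w : X} :
    HNear add nrm (h.point x) (h.point a) (h.point w) ↔ ‖x - a‖ < ‖w‖ := by
  constructor
  · rintro ⟨b, r, r', hb, hr, hr', hle, hne⟩
    obtain ⟨b', a', rfl, ha, hx⟩ := h.app₂_add.1 hb
    rw [h.app_nrm_point] at hr hr'
    have h1 : x - a = b' := by
      rw [h.point_injective hx, h.point_injective ha, add_sub_cancel_right]
    rw [h1]
    have hle' : r.1 ⊆ r'.1 := fun q hq => by
      obtain ⟨q, rfl⟩ := HMem.exists_of_mem hq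
      exact hle q hq
    rw [hr, hr', realCode_subset_realCode] at hle'
    refine lt_of_le_of_ne hle' fun heq => hne (H.ext ?_)
    rw [hr, hr', heq]
  · intro hlt
    refine ⟨h.point (x - a), ⟨_, h.inH_norm (x - a)⟩, ⟨_, h.inH_norm w⟩,
      h.app₂_add_point.2 (sub_add_cancel _ _), h.app_nrm_point.2 rfl, h.app_nrm_point.2 rfl,
      fun q hq => realCode_subset_realCode.2 hlt.le hq, fun heq => hlt.ne ?_⟩
    exact realCode_injective (congrArg Subtype.val heq)

/-- Radii are expressed as norms of nonzero vectors, avoiding any coding of positive reals. In a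
nonzero space every `ε > 0` is such a norm; the nonemptiness clause in `HClosure` covers the zero
space. -/
theorem closure_point {A : H θ} {x : X} :
    HClosure pts add nrm A (h.point x) ↔ x ∈ closure {y | e y ∈ A.1} := by
  have hnz : ∀ w : X, ¬ HApp₂ add (h.point w) (h.point w) (h.point w) ↔ w ≠ 0 := fun w => by
    rw [h.app₂_add_point, _root_.add_eq_left]
  rw [HClosure, h.forall_mem_pts]
  simp only [hnz, h.exists_mem_pts, h.near_point]
  have h0 : (∃ a, HMem a A ∧ HMem a pts) ↔ ∃ y, e y ∈ A.1 := by
    have := h.exists_mem_pts (p := fun _ => True) (q := fun a => HMem a A)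
    simp only [and_true] at this
    exact this
  rw [h0, Metric.mem_closure_iff]
  constructor
  · rintro ⟨-, ⟨y, hy⟩, hw⟩ ε hε
    rcases subsingleton_or_nontrivial X with hX | hX
    · exact ⟨y, hy, by rw [Subsingleton.elim x y, dist_self]; exact hε⟩
    · obtain ⟨w, hw0⟩ := exists_ne (0 : X)
      have hw1 : ‖w‖ ≠ 0 := norm_ne_zero_iff.2 hw0
      have hnorm : ‖(ε / ‖w‖) • w‖ = ε := by
        rw [norm_smul, Real.norm_of_nonneg (by positivity), div_mul_cancel₀ _ hw1]
      obtain ⟨y, hy, hlt⟩ := hw ((ε / ‖w‖) • w) (norm_ne_zero_iff.1 (by rw [hnorm]; exact hε.ne'))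
      exact ⟨y, hy, by rw [dist_eq_norm, ← hnorm]; exact hlt⟩
  · intro hcl
    refine ⟨h.point_mem x, ?_, fun w hw => ?_⟩
    · obtain ⟨y, hy, -⟩ := hcl 1 one_pos
      exact ⟨y, hy⟩
    · obtain ⟨y, hy, hlt⟩ := hcl ‖w‖ (norm_pos_iff.2 hw)
      exact ⟨y, hy, by rwa [← dist_eq_norm]⟩

theorem exists_of_closure {A a : H θ} (ha : HClosure pts add nrm A a) : ∃ x, a = h.point x := by
  obtain ⟨x, hx⟩ := h.mem_pts.1 ha.1
  exact ⟨x, H.ext hx⟩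

theorem agree_point {A : H θ} {x y : X} : HAgree d A (h.point x) (h.point y) ↔
    ∀ φ ∈ D, functionalCode e φ ∈ A.1 → φ x = φ y := by
  have happ : ∀ (φ : StrongDual ℝ X) (x : X) (z : ZFSet.{u}),
      ZFSet.pair (e x) z ∈ functionalCode e φ ↔ z = realCode (φ x) := by
    intro φ x z
    rw [functionalCode, ZFSet.mem_range]
    simp only [ZFSet.pair_inj]
    exact ⟨fun ⟨y, h1, h2⟩ => by rw [← h2, e.injective h1], fun hz => ⟨x, rfl, hz.symm⟩⟩
  constructor
  · intro hag φ hφ hφA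
    obtain ⟨f, hf⟩ := HMem.exists_of_mem hφA
    obtain ⟨r, h1, h2⟩ := hag f (by
      rw [HMem, hf, h.d_eq]; exact ZFSet.mem_range.2 ⟨⟨φ, hφ⟩, rfl⟩) (by rwa [HMem, hf])
    rw [HApp, hf] at h1 h2
    exact realCode_injective (((happ _ _ _).1 h1).symm.trans ((happ _ _ _).1 h2))
  · intro hag f hf hfA
    have hf' : f.1 ∈ functionalSetCode e D := by rw [← h.d_eq]; exact hf
    obtain ⟨φ, hφ⟩ := ZFSet.mem_range.1 hf'
    have hxy := hag φ.1 φ.2 (by rw [hφ]; exact hfA)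
    have h1 : ZFSet.pair (e x) (realCode (φ.1 x)) ∈ f.1 := by rw [← hφ]; exact (happ _ _ _).2 rfl
    refine ⟨⟨_, (InH.mem f.2 h1).snd⟩, h1, ?_⟩
    change ZFSet.pair (e y) (realCode (φ.1 x)) ∈ f.1
    rw [hxy, ← hφ]
    exact (happ _ _ _).2 rfl

theorem app₂_smul_point {t c : H θ} {x : X} :
    HApp₂ smul t (h.point x) c ↔ ∃ s : ℝ, t.1 = realCode s ∧ c = h.point (s • x) := by
  rw [HApp₂, h.smul_eq, ZFSet.mem_range]
  simp only [ZFSet.pair_inj, Prod.exists]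
  refine exists_congr fun s => ?_
  constructor
  · rintro ⟨y, ⟨h1, h2⟩, h3⟩
    rw [e.injective h2] at h3
    exact ⟨h1.symm, H.ext h3.symm⟩
  · rintro ⟨h1, h2⟩
    exact ⟨x, ⟨h1.symm, rfl⟩, by rw [h2]; rfl⟩

theorem inH_real (s : ℝ) : InH θ (realCode s) := by
  have : ZFSet.pair (ZFSet.pair (realCode s) (e 0)) (e (s • 0)) ∈ smul.1 := by
    rw [h.smul_eq]; exact ZFSet.mem_range.2 ⟨(s, 0), rfl⟩
  exact (InH.mem smul.2 this).fst.fst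

/-- Translates between the internal and external decompositions. `HAgree` states that a difference
lies in the annihilator, so its existence and uniqueness clauses become codisjointness and
disjointness. -/
theorem splits_iff {A : H θ} :
    HSplits pts add smul nrm d A ↔ SplitsAt D (elementCode e ⁻¹' {z | z ∈ A.1}) := by
  have hset : {x : X | Sum.inl x ∈ elementCode e ⁻¹' {z | z ∈ A.1}} = {y | e y ∈ A.1} := rfl
  have hfun : {φ ∈ D | Sum.inr φ ∈ elementCode e ⁻¹' {z | z ∈ A.1}} =
    {φ ∈ D | functionalCode e φ ∈ A.1} := rfl
  rw [SplitsAt, hset, hfun]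
  constructor
  · rintro ⟨h1, h2, h3, h4⟩
    have hsmul : ∀ (s : ℝ) {x : X}, x ∈ closure {y | e y ∈ A.1} →
        s • x ∈ closure {y | e y ∈ A.1} := fun s x hx =>
      h.closure_point.1 (h4 (h.point x) ⟨_, h.inH_real s⟩ _ (h.closure_point.2 hx)
        (h.app₂_smul_point.2 ⟨s, rfl, rfl⟩))
    have hmem : ∀ x : X, ∃ y ∈ closure {y | e y ∈ A.1},
        ∀ φ ∈ D, functionalCode e φ ∈ A.1 → φ x = φ y := by
      intro x
      obtain ⟨a, ha, hag⟩ := h1 _ (h.point_mem x)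
      obtain ⟨y, rfl⟩ := h.exists_of_closure ha
      exact ⟨y, h.closure_point.1 ha, h.agree_point.1 hag⟩
    let Y : Submodule ℝ X :=
      { carrier := closure {y | e y ∈ A.1}
        zero_mem' := by
          obtain ⟨y, hy, -⟩ := hmem 0
          simpa using hsmul 0 hy
        add_mem' := fun {x y} hx hy => h.closure_point.1 (h3 _ _ _ (h.closure_point.2 hx)
          (h.closure_point.2 hy) (h.app₂_add_point.2 rfl))
        smul_mem' := fun s x hx => hsmul s hx }
    refine ⟨Y, rfl, ?_, ?_⟩
    · rw [Submodule.disjoint_def]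
      intro x hx hx'
      refine h.point_injective (h2 (h.point x) (h.point 0) (h.closure_point.2 hx)
        (h.app₂_add_point.2 (add_zero _)) (h.agree_point.2 fun φ hφ hφA => ?_))
      rw [map_zero]
      exact hx' φ ⟨hφ, hφA⟩
    · rw [codisjoint_iff, eq_top_iff]
      intro x _
      obtain ⟨y, hy, hag⟩ := hmem x
      refine Submodule.mem_sup.2 ⟨y, hy, x - y, fun φ hφ => ?_, add_sub_cancel _ _⟩
      rw [map_sub, hag φ hφ.1 hφ.2, sub_self]
  · rintro ⟨Y, hY, hdis, hcod⟩
    have hcl : ∀ x, HClosure pts add nrm A (h.point x) ↔ x ∈ Y := fun x => by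
      rw [h.closure_point, ← hY]; rfl
    refine ⟨h.forall_mem_pts.2 fun x => ?_, fun a b ha hb hag => ?_, fun a b c ha hb hc => ?_,
      fun a t c ha hc => ?_⟩
    · have hx : x ∈ Y ⊔ leftAnnihilator {φ ∈ D | functionalCode e φ ∈ A.1} := by
        rw [codisjoint_iff.1 hcod]; trivial
      obtain ⟨y, hy, z, hz, rfl⟩ := Submodule.mem_sup.1 hx
      refine ⟨h.point y, (hcl y).2 hy, h.agree_point.2 fun φ hφ hφA => ?_⟩
      rw [map_add, hz φ ⟨hφ, hφA⟩, add_zero]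
    · obtain ⟨y, rfl⟩ := h.exists_of_closure ha
      obtain ⟨z, z', h1, h2, h3⟩ := h.app₂_add.1 hb
      subst h1
      have hz : z = 0 := by
        have := (h.point_injective h2).symm
        subst this
        simpa using h.point_injective h3
      subst hz
      rw [h.agree_point] at hag
      congr 1
      exact (Submodule.disjoint_def.1 hdis) y ((hcl y).1 ha) fun φ hφ => by
        rw [hag φ hφ.1 hφ.2, map_zero]
    · obtain ⟨y, rfl⟩ := h.exists_of_closure ha
      obtain ⟨z, rfl⟩ := h.exists_of_closure hb
      obtain ⟨y', z', h1, h2, rfl⟩ := h.app₂_add.1 hc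
      rw [hcl] at ha hb ⊢
      rw [← h.point_injective h1, ← h.point_injective h2]
      exact Y.add_mem ha hb
    · obtain ⟨y, rfl⟩ := h.exists_of_closure ha
      obtain ⟨s, -, rfl⟩ := h.app₂_smul_point.1 hc
      rw [hcl] at ha ⊢
      exact Y.smul_mem s ha

end IsCode

end Meaning

/-! ### Generating projections is equivalent to splitting along closed countable sets -/

section Characterization

variable {X : Type u} [NormedAddCommGroup X] [NormedSpace ℝ X]

/-- The family of the codes of all countable sets closed under `c`. -/
noncomputable def closedFamilyCode (e : X ↪ ZFSet.{u})
    (c : Finset (X ⊕ StrongDual ℝ X) → Set (X ⊕ StrongDual ℝ X)) : ZFSet.{u} :=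
  ZFSet.range fun A : {A : Set (X ⊕ StrongDual ℝ X) // A.Countable ∧ IsClosedUnder c A} =>
    ZFSet.range fun s : A.1 => elementCode e s

/-- The hypothesis `hc` makes closed sets saturated for collisions of codes, so each can be
recovered from its code. -/
theorem mem_closedFamilyCode {e : X ↪ ZFSet.{u}}
    {c : Finset (X ⊕ StrongDual ℝ X) → Set (X ⊕ StrongDual ℝ X)}
    (hc : ∀ t : Finset _, elementCode e ⁻¹' (elementCode e '' (t : Set _)) ⊆ c t) {b : ZFSet.{u}} :
    b ∈ closedFamilyCode e c ↔ ∃ A : Set (X ⊕ StrongDual ℝ X), A.Countable ∧ IsClosedUnder c A ∧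
      (b : Set ZFSet.{u}) = elementCode e '' A ∧ elementCode e ⁻¹' (b : Set ZFSet.{u}) = A := by
  have hsat : ∀ A : Set (X ⊕ StrongDual ℝ X), IsClosedUnder c A →
      elementCode e ⁻¹' (elementCode e '' A) = A := by
    refine fun A hA => Set.Subset.antisymm ?_ (Set.subset_preimage_image _ _)
    rintro s ⟨s', hs', hss'⟩
    exact hA {s'} (by simpa using hs') (hc _ ⟨s', by simp, hss'⟩)
  have hrange : ∀ A : Set (X ⊕ StrongDual ℝ X),
      ((ZFSet.range fun s : A => elementCode e s : ZFSet.{u}) : Set ZFSet.{u}) =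
        elementCode e '' A := fun A => by
    rw [ZFSet.coe_range, Set.image_eq_range]
  rw [closedFamilyCode, ZFSet.mem_range]
  constructor
  · rintro ⟨A, rfl⟩
    exact ⟨A.1, A.2.1, A.2.2, hrange _, by rw [hrange, hsat _ A.2.2]⟩
  · rintro ⟨A, hA, hA', hb, -⟩
    exact ⟨⟨A, hA, hA'⟩, SetLike.coe_injective ((hrange A).trans hb.symm)⟩

/-- Covering and directedness hold since every countable set has a countable closed superset. A
countable directed union of closed sets is again countable and closed, so `hsplit` applies to it. -/
theorem IsCode.skeleton {θ : Cardinal.{u}} (hθ : θ.IsRegular) (hθ' : ℵ₀ < θ) {e : X ↪ ZFSet.{u}}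
    {D : Set (StrongDual ℝ X)} {pts add smul nrm d : H θ} (h : IsCode e D pts add smul nrm d)
    {c : Finset (X ⊕ StrongDual ℝ X) → Set (X ⊕ StrongDual ℝ X)} (hcc : ∀ t, (c t).Countable)
    (hc : ∀ t : Finset _, elementCode e ⁻¹' (elementCode e '' (t : Set _)) ⊆ c t)
    (hsplit : ∀ A, A.Countable → IsClosedUnder c A → SplitsAt D A)
    {C : H θ} (hC : C.1 = closedFamilyCode e c) : HSkeleton pts add smul nrm d C := by
  have hmem : ∀ b : H θ, HMem b C ↔ ∃ A : Set (X ⊕ StrongDual ℝ X), A.Countable ∧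
      IsClosedUnder c A ∧ (b.1 : Set ZFSet.{u}) = elementCode e '' A ∧
        elementCode e ⁻¹' (b.1 : Set ZFSet.{u}) = A := fun b => by
    rw [HMem, hC, mem_closedFamilyCode hc]
  have hctbl : ∀ b, HMem b C → (b.1 : Set ZFSet.{u}).Countable := fun b hb => by
    obtain ⟨A, hA, -, hbA, -⟩ := (hmem b).1 hb
    rw [hbA]
    exact hA.image _
  have hcof : ∀ A : Set (X ⊕ StrongDual ℝ X), A.Countable →
      ∃ b, HMem b C ∧ elementCode e '' A ⊆ (b.1 : Set ZFSet.{u}) := by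
    intro A hA
    obtain ⟨B, hAB, hB, hBc⟩ := exists_isClosedUnder_superset hcc hA
    have hb : (ZFSet.range fun s : B => elementCode e s) ∈ C.1 := by
      rw [hC]
      exact ZFSet.mem_range.2 ⟨⟨B, hB, hBc⟩, rfl⟩
    obtain ⟨b, hb'⟩ := HMem.exists_of_mem hb
    refine ⟨b, by rwa [HMem, hb'], ?_⟩
    rw [hb', ZFSet.coe_range, ← Set.image_eq_range]
    exact Set.image_mono hAB
  refine ⟨fun b hb => hCountable_of_countable hθ hθ' (hctbl b hb), fun x hx => ?_,
    ⟨?_, fun b b' hb hb' => ?_⟩, fun F A hFC hF hFd hA => ?_⟩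
  · obtain ⟨s, hs⟩ : ∃ s, elementCode e s = x.1 := by
      rcases hx with hx | hx
      · obtain ⟨y, hy⟩ := h.mem_pts.1 hx
        exact ⟨Sum.inl y, hy.symm⟩
      · rw [HMem, h.d_eq] at hx
        obtain ⟨φ, hφ⟩ := ZFSet.mem_range.1 hx
        exact ⟨Sum.inr φ.1, hφ⟩
    obtain ⟨b, hb, hsb⟩ := hcof {s} (Set.countable_singleton s)
    exact ⟨b, hb, hsb ⟨s, rfl, hs⟩⟩
  · obtain ⟨b, hb, -⟩ := hcof ∅ Set.countable_empty
    exact ⟨b, hb⟩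
  · obtain ⟨A, hA, -, hbA, -⟩ := (hmem b).1 hb
    obtain ⟨A', hA', -, hbA', -⟩ := (hmem b').1 hb'
    obtain ⟨b'', hb'', hsub⟩ := hcof _ (hA.union hA')
    refine ⟨b'', hb'', fun z hz => hsub ?_⟩
    rw [Set.image_union, ← hbA, ← hbA']
    exact hz
  · have hAunion : (A.1 : Set ZFSet.{u}) = ⋃ b ∈ (F.1 : Set ZFSet.{u}), (b : Set ZFSet.{u}) := by
      ext z
      simp only [Set.mem_iUnion]
      constructor
      · intro hz
        obtain ⟨z, rfl⟩ := HMem.exists_of_mem hz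
        obtain ⟨b, hb, hzb⟩ := (hA z).1 hz
        exact ⟨b.1, hb, hzb⟩
      · rintro ⟨b, hb, hzb⟩
        obtain ⟨b, rfl⟩ := HMem.exists_of_mem hb
        obtain ⟨z, rfl⟩ := HMem.exists_of_mem hzb
        exact (hA z).2 ⟨b, hb, hzb⟩
    obtain ⟨a, g, hg⟩ := hF
    have hAc : (A.1 : Set ZFSet.{u}).Countable := by
      rw [hAunion]
      refine (hg.countable hθ hθ').biUnion fun b hb => ?_
      obtain ⟨b, rfl⟩ := HMem.exists_of_mem hb
      exact hctbl b (hFC b hb)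
    have hpre : elementCode e ⁻¹' {z | z ∈ A.1} =
        ⋃₀ {B | ∃ b, HMem b F ∧ elementCode e ⁻¹' (b.1 : Set ZFSet.{u}) = B} := by
      ext s
      constructor
      · intro hs
        obtain ⟨z, hz⟩ := HMem.exists_of_mem hs
        obtain ⟨b, hb, hzb⟩ := (hA z).1 (by rw [HMem, hz]; exact hs)
        exact ⟨_, ⟨b, hb, rfl⟩, by rw [HMem, hz] at hzb; exact hzb⟩
      · rintro ⟨_, ⟨b, hb, rfl⟩, hs⟩
        obtain ⟨z, hz⟩ := HMem.exists_of_mem (a := b) hs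
        have := (hA z).2 ⟨b, hb, by rw [HMem, hz]; exact hs⟩
        rw [HMem, hz] at this
        exact this
    rw [h.splits_iff]
    refine hsplit _ (countable_preimage_elementCode e hAc) ?_
    rw [hpre]
    refine IsClosedUnder.sUnion ?_ ?_ ?_
    · obtain ⟨b, hb⟩ := hFd.1
      exact ⟨_, b, hb, rfl⟩
    · rintro _ ⟨b, hb, rfl⟩ _ ⟨b', hb', rfl⟩
      obtain ⟨b'', hb'', hsub⟩ := hFd.2 b b' hb hb'
      refine ⟨_, ⟨b'', hb'', rfl⟩, Set.preimage_mono fun z hz => ?_, Set.preimage_mono fun z hz => ?_⟩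
      · obtain ⟨z, rfl⟩ := HMem.exists_of_mem hz
        exact hsub z (Or.inl hz)
      · obtain ⟨z, rfl⟩ := HMem.exists_of_mem hz
        exact hsub z (Or.inr hz)
    · rintro _ ⟨b, hb, rfl⟩
      obtain ⟨B, -, hB, -, hbB⟩ := (hmem b).1 (hFC b hb)
      rw [hbB]
      exact hB

theorem exists_isCode {θ : Cardinal.{u}} {e : X ↪ ZFSet.{u}} {D : Set (StrongDual ℝ X)}
    {M : setLanguage.ElementarySubstructure (H θ)} (hX : MemModel M (spaceCode e))
    (hD : MemModel M (functionalSetCode e D)) :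
    ∃ pts ∈ M, ∃ add ∈ M, ∃ smul ∈ M, ∃ nrm ∈ M, ∃ d ∈ M, IsCode e D pts add smul nrm d := by
  obtain ⟨⟨pts, hpts, h1⟩, h⟩ := pair_mem_model hX
  obtain ⟨⟨add, hadd, h2⟩, h⟩ := pair_mem_model h
  obtain ⟨⟨smul, hsmul, h3⟩, ⟨nrm, hnrm, h4⟩⟩ := pair_mem_model h
  obtain ⟨d, hd, h5⟩ := hD
  exact ⟨pts, hpts, add, hadd, smul, hsmul, nrm, hnrm, d, hd, h1, h2, h3, h4, h5⟩

theorem SplitsAtClosed.generatesProjections {D : Set (StrongDual ℝ X)} (h : SplitsAtClosed D) :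
    GeneratesProjections D := by
  intro e
  obtain ⟨c, hcc, hsplit⟩ := h
  -- Enlarging `c` by all elements sharing a code with a member of `t` makes closed sets saturated.
  let c' : Finset (X ⊕ StrongDual ℝ X) → Set (X ⊕ StrongDual ℝ X) := fun t =>
    c t ∪ elementCode e ⁻¹' (elementCode e '' t)
  have hcc' : ∀ t, (c' t).Countable := fun t => (hcc t).union
    (countable_preimage_elementCode e (t.countable_toSet.image _))
  obtain ⟨θ₀, hθ₀⟩ := exists_forall_inH (closedFamilyCode e c')
  refine ⟨max θ₀ (Order.succ ℵ₀), fun θ hθ hle M hM hXM hDM => ?_⟩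
  have hθ' : ℵ₀ < θ := Order.succ_le_iff.1 ((le_max_right _ _).trans hle)
  obtain ⟨pts, hpts, add, hadd, smul, hsmul, nrm, hnrm, d, hd, hcode⟩ := exists_isCode hXM hDM
  let params : ℕ → H θ := seqCons pts <| seqCons add <| seqCons smul <| seqCons nrm fun _ => d
  have hparams : ∀ i, params i ∈ M := by
    rintro (_ | _ | _ | _ | i) <;> assumption
  -- The family built from `c'` need not belong to `M`; it only witnesses existence, and
  -- elementarity supplies a possibly different family `C` in `M`.
  obtain ⟨C, hCM, hC⟩ := (FO.skeleton 1 2 3 4 5 0).exists_mem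
    (Q := fun C v => HSkeleton (v 0) (v 1) (v 2) (v 3) (v 4) C) M (v := params) hparams
    ⟨⟨_, hθ₀ θ ((le_max_left _ _).trans hle)⟩,
      hcode.skeleton hθ hθ' hcc' (fun t => Set.subset_union_right)
        (fun A hA hA' => hsplit A hA fun t ht => Set.subset_union_left.trans (hA' t ht)) rfl⟩
  change HSkeleton pts add smul nrm d C at hC
  obtain ⟨hC1, hC2, hC3, hC4⟩ := hC
  obtain ⟨F, hF⟩ := exists_setOf_mem_model hθ hθ' hM fun b => HMem b C
  obtain ⟨A, hA⟩ := exists_setOf_mem_model hθ hθ' hM fun x => ∃ b, HMem b F ∧ HMem x b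
  have hcover : ∀ x ∈ M, HMem x pts ∨ HMem x d → HMem x A := by
    intro x hx hx'
    obtain ⟨b, hbM, hb⟩ := (FO.and (FO.mem 0 1) (FO.mem 2 0)).exists_mem
      (Q := fun b v => HMem b (v 0) ∧ HMem (v 1) b) M (v := seqCons C fun _ => x)
      (fun i => by cases i <;> assumption) (hC2 x hx')
    exact (hA x).2 ⟨hx, b, (hF b).2 ⟨hbM, hb.1⟩, hb.2⟩
  have hFA : HSplits pts add smul nrm d A := by
    refine hC4 F A (fun b hb => ((hF b).1 hb).2) ?_ ⟨?_, fun b b' hb hb' => ?_⟩ fun z => ?_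
    · refine hCountable_of_countable hθ hθ' ((hM.image Subtype.val).mono fun x hx => ?_)
      obtain ⟨x, rfl⟩ := HMem.exists_of_mem hx
      exact ⟨x, ((hF x).1 hx).1, rfl⟩
    · obtain ⟨b, hbM, hb⟩ := (FO.mem 0 1).exists_mem (Q := fun b v => HMem b (v 0)) M
        (v := fun _ => C) (fun _ => hCM) hC3.1
      exact ⟨b, (hF b).2 ⟨hbM, hb⟩⟩
    · rw [hF] at hb hb'
      have hfo : FO (θ := θ) fun v => HMem (v 0) (v 1) ∧
          ∀ z, HMem z (v 2) ∨ HMem z (v 3) → HMem z (v 0) :=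
        (FO.mem _ _).and <| FO.all <| FO.imp ((FO.mem 0 3).or (FO.mem 0 4)) (FO.mem 0 1)
      obtain ⟨b'', hbM'', hb''⟩ := hfo.exists_mem
        (Q := fun b v => HMem b (v 0) ∧ ∀ z, HMem z (v 1) ∨ HMem z (v 2) → HMem z b) M
        (v := seqCons C <| seqCons b fun _ => b')
        (by rintro (_ | _ | i); exacts [hCM, hb.1, hb'.1]) (hC3.2 b b' hb.2 hb'.2)
      exact ⟨b'', (hF b'').2 ⟨hbM'', hb''.1⟩, hb''.2⟩
    -- Members of `C` that lie in `M` are countable, hence subsets of `M`, so intersecting their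
    -- union with `M` loses nothing.
    · refine (hA z).trans ⟨fun h => h.2, fun h => ⟨?_, h⟩⟩
      obtain ⟨b, hb, hz⟩ := h
      rw [hF] at hb
      exact (hC1 b hb.2).subset hθ hθ' hM hb.1 hz
  have key : ∀ s, (∀ a : H θ, a.1 = elementCode e s → HMem a pts ∨ HMem a d) →
      (s ∈ elementCode e ⁻¹' {z | z ∈ A.1} ↔ MemModel M (elementCode e s)) := by
    intro s hs
    constructor
    · intro h
      obtain ⟨a, ha⟩ := HMem.exists_of_mem h
      exact ⟨a, ((hA a).1 (by rw [HMem, ha]; exact h)).1, ha⟩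
    · rintro ⟨a, haM, ha⟩
      have := hcover a haM (hs a ha)
      rw [HMem, ha] at this
      exact this
  obtain ⟨Y, hY, hcompl⟩ := hcode.splits_iff.1 hFA
  have hpoints : {x | Sum.inl x ∈ elementCode e ⁻¹' {z | z ∈ A.1}} = {x | MemModel M (e x)} := by
    ext x
    exact key (Sum.inl x) fun a ha => Or.inl (hcode.mem_pts.2 ⟨x, ha⟩)
  have hfuns : {φ ∈ D | Sum.inr φ ∈ elementCode e ⁻¹' {z | z ∈ A.1}} = functionalsIn e D M := by
    ext φ
    refine and_congr_right fun hφ => key (Sum.inr φ) fun a ha => Or.inr ?_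
    rw [HMem, hcode.d_eq, ha]
    exact ZFSet.mem_range.2 ⟨⟨φ, hφ⟩, rfl⟩
  rw [hpoints] at hY
  rw [hfuns] at hcompl
  exact ⟨Y, hY, hcompl⟩

theorem exists_embedding_ZFSet (X : Type u) : Nonempty (X ↪ ZFSet.{u}) :=
  ⟨⟨fun x => Ordinal.toZFSet (embeddingToCardinal x).ord, fun _ _ h =>
    embeddingToCardinal.injective (Cardinal.ord_injective (Ordinal.toZFSet_injective h))⟩⟩

instance (n : ℕ) : Countable (SetRel n) :=
  Function.Injective.countable (f := fun _ : SetRel n => ()) fun a b _ => by cases a; cases b; rfl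

instance : Countable (Σ n, (setLanguage.sum setLanguage.skolem₁).Functions n) := by
  rw [← Cardinal.mk_le_aleph0_iff]
  refine card_functions_sum_skolem₁_le.trans (max_le le_rfl ?_)
  have h1 : Countable (Σ n, setLanguage.Functions n) :=
    inferInstanceAs (Countable (Σ _ : ℕ, Empty))
  have h2 : Countable (Σ n, setLanguage.Relations n) :=
    inferInstanceAs (Countable (Σ n : ℕ, SetRel n))
  exact Cardinal.mk_le_aleph0_iff.2 (inferInstanceAs
    (Countable ((Σ n, setLanguage.Functions n) ⊕ Σ n, setLanguage.Relations n)))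

/-- Send a finite set to all points and functionals whose codes lie in the Skolem hull of it
together with `X` and `D`. The hull of a closed countable set `A` is then a countable model whose
points and functionals are exactly `A`. -/
theorem GeneratesProjections.splitsAtClosed {D : Set (StrongDual ℝ X)}
    (h : GeneratesProjections D) : SplitsAtClosed D := by
  obtain ⟨e⟩ := exists_embedding_ZFSet X
  obtain ⟨θ₀, hθ₀⟩ := h e
  obtain ⟨θ₁, hθ₁⟩ := exists_forall_inH (spaceCode e)
  -- All functionals, not only those in `D`, must have codes in `H(θ)`, because the operation acts
  -- on the whole dual.
  obtain ⟨θ₂, hθ₂⟩ := exists_forall_inH (functionalSetCode e (Set.univ : Set (StrongDual ℝ X)))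
  let θ : Cardinal.{u} := Order.succ (max (max θ₀ ℵ₀) (max θ₁ θ₂))
  have hθ : θ.IsRegular := Cardinal.isRegular_succ ((le_max_right _ _).trans (le_max_left _ _))
  have hle : max (max θ₀ ℵ₀) (max θ₁ θ₂) ≤ θ := Order.le_succ _
  have hX : InH θ (spaceCode e) :=
    hθ₁ θ (((le_max_left _ _).trans (le_max_right _ _)).trans hle)
  have hU : InH θ (functionalSetCode e (Set.univ : Set (StrongDual ℝ X))) :=
    hθ₂ θ (((le_max_right _ _).trans (le_max_right _ _)).trans hle)
  have hD : InH θ (functionalSetCode e D) := hU.subset fun z hz => by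
    obtain ⟨φ, rfl⟩ := ZFSet.mem_range.1 hz
    exact ZFSet.mem_range.2 ⟨⟨φ.1, trivial⟩, rfl⟩
  have hk : ∀ s, InH θ (elementCode e s) := by
    rintro (x | φ)
    · exact hX.fst.mem (ZFSet.mem_range.2 ⟨x, rfl⟩)
    · exact hU.mem (ZFSet.mem_range.2 ⟨⟨φ, trivial⟩, rfl⟩)
  let k : X ⊕ StrongDual ℝ X → H θ := fun s => ⟨elementCode e s, hk s⟩
  let P : Set (H θ) := {⟨spaceCode e, hX⟩, ⟨functionalSetCode e D, hD⟩}
  have : Nonempty (H θ) := ⟨⟨spaceCode e, hX⟩⟩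
  let hull : Set (H θ) → (setLanguage.sum setLanguage.skolem₁).Substructure (H θ) := fun s => Substructure.closure _ (P ∪ s)
  have hcount : ∀ s : Set (H θ), s.Countable → (hull s : Set (H θ)).Countable := by
    intro s hs
    have hP : (P ∪ s).Countable := (((Set.finite_singleton _).insert _).countable).union hs
    exact hP.substructure_closure (L := setLanguage.sum setLanguage.skolem₁)
  -- The hull is finitary: each element is a Skolem term in finitely many generators.
  have hfin : ∀ A : Set (X ⊕ StrongDual ℝ X), ∀ a ∈ hull (k '' A),
      ∃ t : Finset (X ⊕ StrongDual ℝ X), (t : Set _) ⊆ A ∧ a ∈ hull (k '' t) := by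
    classical
    intro A a ha
    refine Substructure.closure_induction (p := fun a => ∃ t : Finset (X ⊕ StrongDual ℝ X),
      (t : Set _) ⊆ A ∧ a ∈ hull (k '' t)) ha ?_ ?_
    · rintro a (ha | ⟨s, hs, rfl⟩)
      · exact ⟨∅, by simp, Substructure.subset_closure (Or.inl ha)⟩
      · exact ⟨{s}, by simpa using hs, Substructure.subset_closure (Or.inr ⟨s, by simp, rfl⟩)⟩
    · intro n f x hx
      choose t ht hxt using hx
      refine ⟨Finset.univ.biUnion t, by simpa using ht, ?_⟩
      refine (hull _).fun_mem f x fun i => ?_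
      refine Substructure.closure_mono (Set.union_subset_union_right _ (Set.image_mono ?_)) (hxt i)
      exact_mod_cast Finset.subset_biUnion_of_mem t (Finset.mem_univ i)
  refine ⟨fun t => {s | k s ∈ hull (k '' t)}, fun t => ?_, fun A hA hAc => ?_⟩
  · have h1 := hcount _ (t.countable_toSet.image k)
    refine (countable_preimage_elementCode e (h1.image Subtype.val)).mono ?_
    exact fun s hs => Set.mem_image_of_mem Subtype.val hs
  · let M : setLanguage.ElementarySubstructure (H θ) := (hull (k '' A)).elementarySkolem₁Reduct
    have hmemM : ∀ a : H θ, a ∈ M ↔ a ∈ hull (k '' A) := fun a => Iff.rfl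
    have hsub : P ∪ k '' A ⊆ hull (k '' A) := Substructure.subset_closure
    have hmem : ∀ s, MemModel M (elementCode e s) ↔ s ∈ A := by
      intro s
      constructor
      · rintro ⟨a, haM, ha⟩
        have hak : a = k s := H.ext ha
        subst hak
        obtain ⟨t, htA, ht⟩ := hfin A _ ((hmemM _).1 haM)
        exact hAc t htA ht
      · exact fun hs => ⟨k s, hsub (Or.inr ⟨s, hs, rfl⟩), rfl⟩
    obtain ⟨Y, hY, hcompl⟩ := hθ₀ θ hθ (((le_max_left _ _).trans (le_max_left _ _)).trans hle) M
      (hcount _ (hA.image k)) ⟨_, hsub (Or.inl (Or.inl rfl)), rfl⟩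
      ⟨_, hsub (Or.inl (Or.inr rfl)), rfl⟩
    refine ⟨Y, ?_, ?_⟩
    · rw [hY, inducedSubspace]
      congr 1
      ext x
      exact hmem (Sum.inl x)
    · convert hcompl using 2
      ext φ
      exact and_congr_right fun _ => (hmem (Sum.inr φ)).symm

end Characterization

/-! ### Norming sets -/

section NormingSets

variable {X : Type u} [NormedAddCommGroup X] [NormedSpace ℝ X]

/-- The strict inequality already excludes `φ = 0`, so the quotient and the empty-supremum
convention disappear. -/
theorem isOneNorming_iff {D : Set (StrongDual ℝ X)} :
    IsOneNorming D ↔ ∀ (x : X) (r : ℝ), 0 ≤ r → r < ‖x‖ → ∃ φ ∈ D, r * ‖φ‖ < |φ x| := by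
  have hle : ∀ (x : X), ∀ y ∈ (fun φ : StrongDual ℝ X => |φ x| / ‖φ‖) '' (D \ {0}), y ≤ ‖x‖ := by
    rintro x _ ⟨φ, hφ, rfl⟩
    have h0 : 0 < ‖φ‖ := norm_pos_iff.2 hφ.2
    rw [div_le_iff₀ h0, mul_comm]
    exact φ.le_opNorm x
  refine forall_congr' fun x => ⟨fun h r hr hrx => ?_, fun h => ?_⟩
  · rcases ((fun φ : StrongDual ℝ X => |φ x| / ‖φ‖) '' (D \ {0})).eq_empty_or_nonempty with h0 | h0
    · rw [h0, Real.sSup_empty] at h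
      linarith
    · rw [h] at hrx
      obtain ⟨_, ⟨φ, hφ, rfl⟩, hlt⟩ := exists_lt_of_lt_csSup h0 hrx
      exact ⟨φ, hφ.1, (lt_div_iff₀ (norm_pos_iff.2 hφ.2)).1 hlt⟩
  · refine le_antisymm (le_of_forall_lt fun r hr => ?_) (Real.sSup_le (hle x) (norm_nonneg x))
    rcases lt_or_ge r 0 with hr0 | hr0
    · refine hr0.trans_le (Real.sSup_nonneg ?_)
      rintro _ ⟨φ, -, rfl⟩
      positivity
    · obtain ⟨φ, hφ, hlt⟩ := h r hr0 hr
      have hφ0 : φ ≠ 0 := by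
        rintro rfl
        simp at hlt
      refine ((lt_div_iff₀ (norm_pos_iff.2 hφ0)).2 hlt).trans_le ?_
      exact le_csSup ⟨_, hle x⟩ ⟨φ, ⟨hφ, hφ0⟩, rfl⟩

/-- The set `B` norms the point `x`. -/
def Norms (B : Set (StrongDual ℝ X)) (x : X) : Prop :=
  ∀ r : ℝ, 0 ≤ r → r < ‖x‖ → ∃ φ ∈ B, r * ‖φ‖ < |φ x|

theorem Norms.mono {B B' : Set (StrongDual ℝ X)} {x : X} (h : Norms B x) (hB : B ⊆ B') :
    Norms B' x := fun r hr hrx => by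
  obtain ⟨φ, hφ, hlt⟩ := h r hr hrx
  exact ⟨φ, hB hφ, hlt⟩

/-- One functional for each rational `r` is enough. -/
theorem Norms.exists_countable {B : Set (StrongDual ℝ X)} {x : X} (h : Norms B x) :
    ∃ N ⊆ B, N.Countable ∧ Norms N x := by
  have h' : ∀ q : {q : ℚ // 0 ≤ q ∧ (q : ℝ) < ‖x‖}, ∃ φ ∈ B, (q : ℝ) * ‖φ‖ < |φ x| := fun q =>
    h q (by exact_mod_cast q.2.1) q.2.2
  choose f hfB hf using h'
  refine ⟨Set.range f, Set.range_subset_iff.2 hfB, Set.countable_range f, fun r hr hrx => ?_⟩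
  obtain ⟨q, hq1, hq2⟩ := exists_rat_btwn hrx
  have hq0 : 0 ≤ q := by exact_mod_cast hr.trans hq1.le
  exact ⟨_, ⟨⟨q, hq0, hq2⟩, rfl⟩, (mul_le_mul_of_nonneg_right hq1.le (norm_nonneg _)).trans_lt
    (hf ⟨q, hq0, hq2⟩)⟩

/-- The projection along the annihilator has norm at most one: functionals in `B` cannot see `z`,
yet they nearly compute the norm of points of `U` close to `y`. -/
theorem norm_le_norm_add_of_norms {U : Set X} {B : Set (StrongDual ℝ X)}
    (h : ∀ x ∈ U, Norms B x) {y z : X} (hy : y ∈ closure U) (hz : z ∈ leftAnnihilator B) :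
    ‖y‖ ≤ ‖y + z‖ := by
  by_contra! hlt
  obtain ⟨x, hx, hxy⟩ := Metric.mem_closure_iff.1 hy ((‖y‖ - ‖y + z‖) / 2) (by linarith)
  rw [dist_eq_norm] at hxy
  have h1 : ‖y‖ ≤ ‖x‖ + ‖y - x‖ := by
    simpa using norm_add_le x (y - x)
  -- This is exactly the upper bound for `|φ x| / ‖φ‖` given by `x = (y + z) - (y - x) - z` and `φ z
  -- = 0`.
  obtain ⟨φ, hφ, hφx⟩ := h x hx (‖y + z‖ + ‖y - x‖) (by positivity) (by linarith)
  have h2 : φ x = φ (y + z) - φ (y - x) := by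
    rw [map_add, hz φ hφ, map_sub]; ring
  have h3 : |φ x| ≤ ‖φ‖ * ‖y + z‖ + ‖φ‖ * ‖y - x‖ := by
    rw [h2]
    exact (abs_sub _ _).trans (add_le_add (φ.le_opNorm _) (φ.le_opNorm _))
  nlinarith

/-- Scale a near-maximizer of `g` on the unit ball by `R`. The tolerance is divided by `R + 1` so
that `R = 0` is allowed. -/
theorem exists_norm_le_and_le_apply (g : StrongDual ℝ X) {R ε : ℝ} (hR : 0 ≤ R) (hε : 0 < ε) :
    ∃ v : X, ‖v‖ ≤ R ∧ ‖g‖ * R - ε ≤ g v := by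
  obtain ⟨x, hx, hgx⟩ := g.exists_lt_apply_of_lt_opNorm
    (show ‖g‖ - ε / (R + 1) < ‖g‖ by have : 0 < ε / (R + 1) := by positivity
                                     linarith)
  have key : ∀ w : X, ‖w‖ < 1 → ‖g‖ - ε / (R + 1) < g w → ∃ v : X, ‖v‖ ≤ R ∧ ‖g‖ * R - ε ≤ g v := by
    intro w hw hgw
    refine ⟨R • w, ?_, ?_⟩
    · rw [norm_smul, Real.norm_of_nonneg hR]
      nlinarith
    · have h1 : R * (ε / (R + 1)) ≤ ε := by
        rw [mul_div_assoc', div_le_iff₀ (by positivity)]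
        nlinarith
      rw [map_smul, smul_eq_mul]
      nlinarith [mul_le_mul_of_nonneg_left hgw.le hR]
  rcases abs_choice (g x) with h | h
  · exact key x hx (by rwa [Real.norm_eq_abs, h] at hgx)
  · exact key (-x) (by rwa [norm_neg]) (by rwa [Real.norm_eq_abs, h, ← map_neg] at hgx)

theorem exists_smul_norm_le_and_le_apply {D : Set (StrongDual ℝ X)} (h0 : 0 ∈ D)
    (hD : IsOneNorming D) (g : StrongDual ℝ X) (x : X) {ε : ℝ} (hε : 0 < ε) :
    ∃ φ ∈ D, ∃ t : ℝ, ‖t • φ‖ ≤ ‖g‖ ∧ g x - ε ≤ t * φ x := by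
  rcases le_or_gt (g x - ε) 0 with hg | hg
  · exact ⟨0, h0, 0, by simp, by simpa using hg⟩
  · have hgx : g x ≤ ‖g‖ * ‖x‖ := (le_abs_self _).trans (g.le_opNorm x)
    have hg0 : 0 < ‖g‖ := by
      by_contra! h
      have := le_antisymm h (norm_nonneg g)
      rw [this, zero_mul] at hgx
      linarith
    obtain ⟨φ, hφ, hlt⟩ := isOneNorming_iff.1 hD x ((g x - ε) / ‖g‖) (by positivity)
      ((div_lt_iff₀ hg0).2 (by linarith))
    have hφ0 : 0 < ‖φ‖ := norm_pos_iff.2 (by rintro rfl; simp at hlt)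
    have hle : g x - ε ≤ ‖g‖ / ‖φ‖ * |φ x| := by
      rw [div_mul_eq_mul_div, le_div_iff₀ hφ0]
      rw [div_mul_eq_mul_div, div_lt_iff₀ hg0] at hlt
      linarith
    have hn : ∀ t : ℝ, |t| = ‖g‖ / ‖φ‖ → ‖t • φ‖ ≤ ‖g‖ := fun t ht => by
      rw [norm_smul, Real.norm_eq_abs, ht, div_mul_cancel₀ _ hφ0.ne']
    have hpos : |‖g‖ / ‖φ‖| = ‖g‖ / ‖φ‖ := abs_of_pos (by positivity)
    rcases abs_choice (φ x) with h | h
    · exact ⟨φ, hφ, ‖g‖ / ‖φ‖, hn _ hpos, by rwa [h] at hle⟩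
    · exact ⟨φ, hφ, -(‖g‖ / ‖φ‖), hn _ (by rw [abs_neg, hpos]), by rw [h] at hle; linarith⟩

end NormingSets

/-! ### Sums with a monotone norm -/

section MonotoneSum

variable {ι : Type u} {X : ι → Type u} [∀ i, NormedAddCommGroup (X i)] [∀ i, NormedSpace ℝ (X i)]
  {S : Type u} [NormedAddCommGroup S] [NormedSpace ℝ S]

/-- `S` is a sum of the spaces `X i` in which each element is the sum of its components, and
families dominated in norm by an element are the components of an element of no greater norm. -/
structure IsMonotoneSum (incl : ∀ i, X i →L[ℝ] S) (proj : ∀ i, S →L[ℝ] X i) : Prop where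
  proj_incl : ∀ i x, proj i (incl i x) = x
  proj_incl_of_ne : ∀ i j x, i ≠ j → proj i (incl j x) = 0
  hasSum : ∀ x, HasSum (fun i => incl i (proj i x)) x
  exists_of_norm_le : ∀ (x : S) (y : ∀ i, X i), (∀ i, ‖y i‖ ≤ ‖proj i x‖) →
    ∃ z, (∀ i, proj i z = y i) ∧ ‖z‖ ≤ ‖x‖

namespace IsMonotoneSum

variable {incl : ∀ i, X i →L[ℝ] S} {proj : ∀ i, S →L[ℝ] X i} (h : IsMonotoneSum incl proj)

include h

theorem ext {x y : S} (hxy : ∀ i, proj i x = proj i y) : x = y := by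
  have hx := h.hasSum x
  simp only [hxy] at hx
  exact hx.unique (h.hasSum y)

theorem norm_le {x z : S} (hxz : ∀ i, ‖proj i z‖ ≤ ‖proj i x‖) : ‖z‖ ≤ ‖x‖ := by
  obtain ⟨w, hw, hwx⟩ := h.exists_of_norm_le x (fun i => proj i z) hxz
  rwa [← h.ext hw]

theorem countable_support (x : S) : {i | proj i x ≠ 0}.Countable := by
  refine (h.hasSum x).summable.countable_support.mono fun i hi => ?_
  rw [Function.mem_support]
  intro h0
  apply hi
  rw [← h.proj_incl i (proj i x), h0, map_zero]

theorem apply_eq_zero {φ : StrongDual ℝ S} {x : S} (hx : ∀ i, φ (incl i (proj i x)) = 0) :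
    φ x = 0 := by
  have := (h.hasSum x).mapL φ
  simp only [hx] at this
  exact this.unique hasSum_zero

theorem proj_sum_incl [DecidableEq ι] (F : Finset ι) (y : ∀ i, X i) (i : ι) :
    proj i (∑ j ∈ F, incl j (y j)) = if i ∈ F then y i else 0 := by
  rw [map_sum]
  split_ifs with hi
  · rw [Finset.sum_eq_single i (fun j _ hj => h.proj_incl_of_ne i j _ hj.symm)
      (fun hi' => absurd hi hi'), h.proj_incl]
  · exact Finset.sum_eq_zero fun j hj => h.proj_incl_of_ne i j _ fun hij => hi (hij ▸ hj)

/-- A Hölder inequality from monotonicity alone: replace each component of `y` by a vector of no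
larger norm on which `g` is almost maximal, then apply `g` to their sum. -/
theorem sum_norm_mul_norm_le (g : StrongDual ℝ S) (y : S) (F : Finset ι) :
    ∑ i ∈ F, ‖g.comp (incl i)‖ * ‖proj i y‖ ≤ ‖g‖ * ‖y‖ := by
  classical
  refine le_of_forall_pos_le_add fun ε hε => ?_
  have hε' : 0 < ε / (F.card + 1) := by positivity
  choose v hv hgv using fun i => exists_norm_le_and_le_apply (g.comp (incl i))
    (norm_nonneg (proj i y)) hε'
  have hz : ‖∑ i ∈ F, incl i (v i)‖ ≤ ‖y‖ := h.norm_le fun i => by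
    rw [h.proj_sum_incl]
    split_ifs
    · exact hv i
    · simp
  have h1 : g (∑ i ∈ F, incl i (v i)) ≤ ‖g‖ * ‖y‖ :=
    (le_abs_self _).trans ((g.le_opNorm _).trans (by gcongr))
  rw [map_sum] at h1
  have h2 : ∑ i ∈ F, (‖g.comp (incl i)‖ * ‖proj i y‖ - ε / (F.card + 1)) ≤
      ∑ i ∈ F, g (incl i (v i)) := Finset.sum_le_sum fun i _ => hgv i
  rw [Finset.sum_sub_distrib, Finset.sum_const, nsmul_eq_mul] at h2
  have h3 : F.card * (ε / (F.card + 1)) ≤ ε := by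
    rw [mul_div_assoc', div_le_iff₀ (by positivity)]
    nlinarith
  linarith

theorem comp_proj_comp_incl (i : ι) (φ : StrongDual ℝ (X i)) :
    (φ.comp (proj i)).comp (incl i) = φ := by
  ext x
  simp [h.proj_incl]

theorem comp_proj_comp_incl_of_ne {i j : ι} (hij : i ≠ j) (φ : StrongDual ℝ (X i)) :
    (φ.comp (proj i)).comp (incl j) = 0 := by
  ext x
  simp [h.proj_incl_of_ne i j x hij]

theorem comp_proj_mem_sumFunctionals {D : ∀ i, Set (StrongDual ℝ (X i))} (h0 : ∀ i, 0 ∈ D i)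
    {i : ι} {φ : StrongDual ℝ (X i)} (hφ : φ ∈ D i) :
    φ.comp (proj i) ∈ sumFunctionals incl D := by
  refine ⟨fun j => ?_, (Set.countable_singleton i).mono fun j hj => ?_⟩
  · rcases eq_or_ne i j with rfl | hij
    · rwa [h.comp_proj_comp_incl]
    · rw [h.comp_proj_comp_incl_of_ne hij]
      exact h0 j
  · by_contra hij
    exact hj (h.comp_proj_comp_incl_of_ne (fun h' => hij h'.symm) φ)

/-- In a supremum norm one coordinate nearly attains the norm, so functionals supported at one index
suffice and no scaling of `D` is needed. -/
theorem isOneNorming_of_norm_proj_le {D : ∀ i, Set (StrongDual ℝ (X i))} (h0 : ∀ i, 0 ∈ D i)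
    (hD : ∀ i, IsOneNorming (D i)) (hproj : ∀ i x, ‖proj i x‖ ≤ ‖x‖)
    (hnorm : ∀ (x : S) (r : ℝ), r < ‖x‖ → 0 ≤ r → ∃ i, r < ‖proj i x‖) :
    IsOneNorming (sumFunctionals incl D) := by
  rw [isOneNorming_iff]
  intro x r hr hrx
  obtain ⟨i, hi⟩ := hnorm x r hrx hr
  obtain ⟨φ, hφ, hlt⟩ := isOneNorming_iff.1 (hD i) (proj i x) r hr hi
  refine ⟨_, h.comp_proj_mem_sumFunctionals h0 hφ, lt_of_le_of_lt ?_ hlt⟩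
  refine mul_le_mul_of_nonneg_left ?_ hr
  refine ContinuousLinearMap.opNorm_le_bound _ (norm_nonneg _) fun y => ?_
  exact (φ.le_opNorm _).trans (mul_le_mul_of_nonneg_left (hproj i y) (norm_nonneg _))

/-- Take `g` of norm one with `g x = ‖x‖`, truncate it to a finite set `F`, and replace its
restriction to each summand by a real multiple of some `φ i ∈ D i` of no larger norm. If `x` were
not normed, rational combinations of the `φ i` would satisfy a closed homogeneous inequality, hence
so would real ones, contradicting this choice. -/
theorem isOneNorming_of_smul_mem {D : ∀ i, Set (StrongDual ℝ (X i))} (h0 : ∀ i, 0 ∈ D i)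
    (hD : ∀ i, IsOneNorming (D i))
    (hsmul : ∀ i, ∀ φ ∈ D i, ∀ q : ℚ, |q| ≤ 1 → (q : ℝ) • φ ∈ D i) :
    IsOneNorming (sumFunctionals incl D) := by
  classical
  rw [isOneNorming_iff]
  intro x r hr hrx
  by_contra! hcon
  have hx0 : ‖x‖ ≠ 0 := (hr.trans_lt hrx).ne'
  obtain ⟨g, hg1, hgx⟩ := exists_dual_vector ℝ x hx0
  have hsum := (h.hasSum x).mapL g
  have hlt : r < g x := by rw [hgx]; exact_mod_cast hrx
  obtain ⟨F, hF⟩ := (hsum.eventually (lt_mem_nhds hlt)).exists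
  let ε := (∑ i ∈ F, g (incl i (proj i x)) - r) / (F.card + 1)
  have hε : 0 < ε := div_pos (by linarith) (by positivity)
  choose φ hφ t hnorm happ using fun i =>
    exists_smul_norm_le_and_le_apply (h0 i) (hD i) (g.comp (incl i)) (proj i x) hε
  let ψ : (ι → ℝ) → StrongDual ℝ S := fun s => ∑ i ∈ F, s i • (φ i).comp (proj i)
  have hψ : Continuous ψ := by fun_prop
  have hψincl : ∀ s j, (ψ s).comp (incl j) = if j ∈ F then s j • φ j else 0 := by
    intro s j
    ext y
    simp only [ψ, ContinuousLinearMap.comp_apply, sum_apply,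
      smul_apply]
    split_ifs with hj
    · rw [Finset.sum_eq_single j (fun i _ hij => by rw [h.proj_incl_of_ne i j y hij]; simp)
        (fun hj' => absurd hj hj'), h.proj_incl]
      rfl
    · exact Finset.sum_eq_zero fun i hi => by
        rw [h.proj_incl_of_ne i j y (by rintro rfl; exact hj hi)]; simp
  have hbound : ∀ s, |ψ s x| ≤ r * ‖ψ s‖ := by
    have hclosed : IsClosed {s | |ψ s x| ≤ r * ‖ψ s‖} :=
      isClosed_le (by fun_prop) (by fun_prop)
    have hdense : DenseRange fun (q : ι → ℚ) (i : ι) => (q i : ℝ) :=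
      DenseRange.piMap fun _ => Rat.denseRange_cast
    refine fun s => hdense.induction_on s hclosed fun q => ?_
    -- Dividing by the common bound `N + 1` brings the coefficients into `[-1, 1]`; homogeneity
    -- undoes the scaling.
    obtain ⟨N, hN⟩ : ∃ N : ℕ, ∀ i ∈ F, |q i| ≤ N + 1 := by
      obtain ⟨N, hN⟩ := exists_nat_ge (∑ i ∈ F, |q i|)
      refine ⟨N, fun i hi => ?_⟩
      have := Finset.single_le_sum (f := fun i => |q i|) (fun i _ => abs_nonneg _) hi
      linarith
    have hN0 : (0 : ℝ) < N + 1 := by positivity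
    have hmem : ψ (fun i => ((q i / (N + 1) : ℚ) : ℝ)) ∈ sumFunctionals incl D := by
      refine ⟨fun j => ?_, F.countable_toSet.mono fun j hj => ?_⟩
      · rw [hψincl]
        split_ifs with hj
        · refine hsmul j _ (hφ j) _ ?_
          rw [abs_div, abs_of_pos (by positivity : (0 : ℚ) < N + 1),
            div_le_one (by positivity)]
          exact hN j hj
        · exact h0 j
      · by_contra hjF
        exact hj ((hψincl _ j).trans (if_neg fun hj' => hjF hj'))
    have hscale : ψ (fun i => (q i : ℝ)) = (N + 1 : ℝ) • ψ (fun i => ((q i / (N + 1) : ℚ) : ℝ)) := by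
      simp only [ψ, Finset.smul_sum, smul_smul]
      refine Finset.sum_congr rfl fun i _ => ?_
      congr 1
      push_cast
      field_simp
    have := hcon _ hmem
    rw [hscale, norm_smul, smul_apply, smul_eq_mul, abs_mul,
      Real.norm_of_nonneg hN0.le, abs_of_pos hN0]
    nlinarith
  have hψ1 : ‖ψ t‖ ≤ 1 := by
    refine ContinuousLinearMap.opNorm_le_bound _ zero_le_one fun y => ?_
    have h1 : ‖ψ t y‖ ≤ ∑ i ∈ F, ‖g.comp (incl i)‖ * ‖proj i y‖ := by
      simp only [ψ, sum_apply]
      refine norm_sum_le_of_le _ fun i _ => ?_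
      exact ((t i • φ i).le_opNorm (proj i y)).trans
        (mul_le_mul_of_nonneg_right (hnorm i) (norm_nonneg _))
    have h2 := h.sum_norm_mul_norm_le g y F
    rw [hg1] at h2
    exact h1.trans h2
  have h1 : r < ψ t x := by
    have h2 : ∑ i ∈ F, (g (incl i (proj i x)) - ε) ≤ ψ t x := by
      simp only [ψ, sum_apply]
      exact Finset.sum_le_sum fun i _ => happ i
    rw [Finset.sum_sub_distrib, Finset.sum_const, nsmul_eq_mul] at h2
    have h3 : F.card * ε < ∑ i ∈ F, g (incl i (proj i x)) - r := by
      rw [mul_div_assoc', div_lt_iff₀ (by positivity)]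
      nlinarith
    linarith
  have h2 := hbound t
  have h3 := le_abs_self (ψ t x)
  nlinarith

end IsMonotoneSum

end MonotoneSum

/-! ### Splitting of sums -/

section Sections

variable {ι : Type u} {X : ι → Type u} [∀ i, NormedAddCommGroup (X i)] [∀ i, NormedSpace ℝ (X i)]
  {S : Type u} [NormedAddCommGroup S] [NormedSpace ℝ S]

/-- The component of a point, or the restriction of a functional. -/
noncomputable def component (incl : ∀ i, X i →L[ℝ] S) (proj : ∀ i, S →L[ℝ] X i) (i : ι) :
    S ⊕ StrongDual ℝ S → X i ⊕ StrongDual ℝ (X i) :=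
  Sum.map (proj i) fun φ => φ.comp (incl i)

/-- The embedding of points and functionals of a summand. -/
noncomputable def lift (incl : ∀ i, X i →L[ℝ] S) (proj : ∀ i, S →L[ℝ] X i) (i : ι) :
    X i ⊕ StrongDual ℝ (X i) → S ⊕ StrongDual ℝ S :=
  Sum.map (incl i) fun φ => φ.comp (proj i)

/-- The index `i` belongs to the support of the point, or of the functional in `E`. -/
def InSupport (incl : ∀ i, X i →L[ℝ] S) (proj : ∀ i, S →L[ℝ] X i) (E : Set (StrongDual ℝ S))
    (i : ι) : S ⊕ StrongDual ℝ S → Prop :=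
  Sum.elim (fun x => proj i x ≠ 0) fun φ => φ ∈ E ∧ φ.comp (incl i) ≠ 0

namespace IsMonotoneSum

variable {incl : ∀ i, X i →L[ℝ] S} {proj : ∀ i, S →L[ℝ] X i} (h : IsMonotoneSum incl proj)

include h

theorem component_lift (i : ι) (s : X i ⊕ StrongDual ℝ (X i)) :
    component incl proj i (lift incl proj i s) = s := by
  rcases s with x | φ
  · exact congrArg Sum.inl (h.proj_incl i x)
  · exact congrArg Sum.inr (h.comp_proj_comp_incl i φ)

theorem countable_inSupport (D : ∀ i, Set (StrongDual ℝ (X i))) (s : S ⊕ StrongDual ℝ S) :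
    {i | InSupport incl proj (sumFunctionals incl D) i s}.Countable := by
  rcases s with x | φ
  · exact h.countable_support x
  · by_cases hφ : φ ∈ sumFunctionals incl D
    · exact hφ.2.mono fun i hi => hi.2
    · exact Set.countable_empty.mono fun i hi => hφ hi.1

/-- A set of points and functionals of the sum splits the sum if it contains `0`, is closed under
addition of points, and, at each index in its support, has a section that splits the summand, is
norming for its own points, and embeds into the set. -/
theorem splitsAt {D : ∀ i, Set (StrongDual ℝ (X i))} (h0 : ∀ i, 0 ∈ D i)
    {A : Set (S ⊕ StrongDual ℝ S)} (hA0 : Sum.inl 0 ∈ A)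
    (hAadd : ∀ x y, Sum.inl x ∈ A → Sum.inl y ∈ A → Sum.inl (x + y) ∈ A)
    (hA : ∀ i, (∃ s ∈ A, InSupport incl proj (sumFunctionals incl D) i s) →
      SplitsAt (D i) (component incl proj i '' A) ∧
      (∀ s ∈ component incl proj i '' A, lift incl proj i s ∈ A) ∧
      ∀ x, Sum.inl x ∈ component incl proj i '' A →
        Norms {φ ∈ D i | Sum.inr φ ∈ component incl proj i '' A} x) :
    SplitsAt (sumFunctionals incl D) A := by
  classical
  let I : Set ι := {i | ∃ s ∈ A, InSupport incl proj (sumFunctionals incl D) i s}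
  let B : ∀ i, Set (X i ⊕ StrongDual ℝ (X i)) := fun i => component incl proj i '' A
  -- Outside `I` all points of `A` have component zero, so the local subspace there is trivial.
  have hY : ∀ i, ∃ Y : Submodule ℝ (X i), (i ∉ I → Y = ⊥) ∧ (i ∈ I → (Y : Set (X i)) =
      closure {x | Sum.inl x ∈ B i} ∧ IsCompl Y (leftAnnihilator {φ ∈ D i | Sum.inr φ ∈ B i})) := by
    intro i
    by_cases hi : i ∈ I
    · obtain ⟨Y, hY⟩ := (hA i hi).1
      exact ⟨Y, fun hi' => absurd hi hi', fun _ => hY⟩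
    · exact ⟨⊥, fun _ => rfl, fun hi' => absurd hi' hi⟩
  choose Y hYbot hYI using hY
  have hcompPt : ∀ {x : S} (i : ι), Sum.inl x ∈ A → Sum.inl (proj i x) ∈ B i := fun i hx =>
    ⟨_, hx, rfl⟩
  have hcompFun : ∀ {φ : StrongDual ℝ S} (i : ι), Sum.inr φ ∈ A →
      Sum.inr (φ.comp (incl i)) ∈ B i := fun i hφ => ⟨_, hφ, rfl⟩
  let Z : Submodule ℝ S := ⨅ i, (Y i).comap (proj i).toLinearMap
  have hZ : ∀ x, x ∈ Z ↔ ∀ i, proj i x ∈ Y i := fun x => by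
    simp [Z, Submodule.mem_iInf]
  have hYclosed : ∀ i, IsClosed (Y i : Set (X i)) := fun i => by
    by_cases hi : i ∈ I
    · rw [(hYI i hi).1]; exact isClosed_closure
    · rw [hYbot i hi]; exact isClosed_singleton
  have hZclosed : IsClosed (Z : Set S) := by
    have : (Z : Set S) = ⋂ i, proj i ⁻¹' (Y i : Set (X i)) := by
      ext x
      simp only [Set.mem_iInter]
      exact hZ x
    rw [this]
    exact isClosed_iInter fun i => (hYclosed i).preimage (proj i).continuous
  have hYmem : ∀ i ∈ I, ∀ {x : X i}, Sum.inl x ∈ B i → x ∈ Y i := fun i hi x hx => by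
    change x ∈ (Y i : Set (X i))
    rw [(hYI i hi).1]
    exact subset_closure hx
  refine ⟨Z, Set.Subset.antisymm ?_ ?_, ?_, ?_⟩
  · intro x hx
    let W : AddSubmonoid S :=
      { carrier := {x | Sum.inl x ∈ A}
        zero_mem' := hA0
        add_mem' := fun {x y} hx hy => hAadd x y hx hy }
    have hW : ∀ i, incl i (proj i x) ∈ W.topologicalClosure := by
      intro i
      by_cases hi : i ∈ I
      · have hxi : proj i x ∈ closure {x | Sum.inl x ∈ B i} := by
          rw [← (hYI i hi).1]
          exact (hZ x).1 hx i
        exact map_mem_closure (incl i).continuous hxi fun y hy => (hA i hi).2.1 _ hy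
      · have := (hZ x).1 hx i
        rw [hYbot i hi, Submodule.mem_bot] at this
        rw [this, map_zero]
        exact W.topologicalClosure.zero_mem
    exact W.isClosed_topologicalClosure.mem_of_tendsto (h.hasSum x)
      (Filter.Eventually.of_forall fun F => sum_mem fun i _ => hW i)
  · refine hZclosed.closure_subset_iff.2 fun x hx => (hZ x).2 fun i => ?_
    by_cases hi : i ∈ I
    · exact hYmem i hi (hcompPt i hx)
    · have : proj i x = 0 := by
        by_contra hne
        exact hi ⟨_, hx, hne⟩
      rw [this]
      exact (Y i).zero_mem
  · rw [Submodule.disjoint_def]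
    intro x hx hx'
    refine h.ext fun i => ?_
    rw [map_zero]
    by_cases hi : i ∈ I
    · refine (Submodule.disjoint_def.1 (hYI i hi).2.disjoint) _ ((hZ x).1 hx i) fun φ hφ => ?_
      exact hx' _ ⟨h.comp_proj_mem_sumFunctionals h0 hφ.1, (hA i hi).2.1 _ hφ.2⟩
    · have := (hZ x).1 hx i
      rwa [hYbot i hi] at this
  · rw [codisjoint_iff, eq_top_iff]
    intro x _
    -- The norm bound is what lets the local components be assembled into an element of the sum.
    have hdec : ∀ i, ∃ y ∈ Y i, ‖y‖ ≤ ‖proj i x‖ ∧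
        (i ∈ I → proj i x - y ∈ leftAnnihilator {φ ∈ D i | Sum.inr φ ∈ B i}) := by
      intro i
      by_cases hi : i ∈ I
      · have hx : proj i x ∈ Y i ⊔ leftAnnihilator {φ ∈ D i | Sum.inr φ ∈ B i} := by
          rw [codisjoint_iff.1 (hYI i hi).2.codisjoint]
          trivial
        obtain ⟨y, hy, z, hz, hyz⟩ := Submodule.mem_sup.1 hx
        refine ⟨y, hy, ?_, fun _ => ?_⟩
        · rw [← hyz]
          refine norm_le_norm_add_of_norms (hA i hi).2.2 ?_ hz
          rw [← SetLike.mem_coe, (hYI i hi).1] at hy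
          exact hy
        · rwa [← hyz, add_sub_cancel_left]
      · exact ⟨0, (Y i).zero_mem, by simp, fun hi' => absurd hi' hi⟩
    choose y hyY hyx hyann using hdec
    obtain ⟨z, hz, -⟩ := h.exists_of_norm_le x y hyx
    refine Submodule.mem_sup.2 ⟨z, (hZ z).2 fun i => by rw [hz]; exact hyY i, x - z, fun φ hφ => ?_,
      add_sub_cancel _ _⟩
    refine h.apply_eq_zero fun i => ?_
    -- A nonzero restriction puts `i` in `I`, where the local decomposition makes it vanish on the
    -- difference.
    by_cases hφi : φ.comp (incl i) = 0
    · exact DFunLike.congr_fun hφi _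
    · rw [map_sub, hz]
      exact hyann i ⟨_, hφ.2, hφ.1, hφi⟩ (φ.comp (incl i)) ⟨hφ.1.1 i, hcompFun i hφ.2⟩

/-- The operation adds `0`, sums of points and, at each index in the support of `t`, the embedded
images of local closures, components and norming functionals. Countable supports keep its values
countable. -/
theorem splitsAtClosed {D : ∀ i, Set (StrongDual ℝ (X i))} (h0 : ∀ i, 0 ∈ D i)
    (hD : ∀ i, IsOneNorming (D i)) (hsplit : ∀ i, SplitsAtClosed (D i)) :
    SplitsAtClosed (sumFunctionals incl D) := by
  classical
  choose c hc hcsplit using hsplit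
  choose N hND hN hNorms using fun (i : ι) (x : X i) =>
    Norms.exists_countable (B := D i) (x := x) (isOneNorming_iff.1 (hD i) x)
  let nf : ∀ i, X i ⊕ StrongDual ℝ (X i) → Set (X i ⊕ StrongDual ℝ (X i)) := fun i =>
    Sum.elim (fun x => Sum.inr '' N i x) fun _ => ∅
  let loc : ∀ i, Finset (S ⊕ StrongDual ℝ S) → Set (X i ⊕ StrongDual ℝ (X i)) := fun i t =>
    -- Taking all subsets makes `loc i` monotone in `t`, although `c i` need not be.
    (⋃ t' ∈ (t.image (component incl proj i)).powerset, c i t') ∪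
      ⋃ s ∈ t.image (component incl proj i), insert s (nf i s)
  have hloc : ∀ i t, (loc i t).Countable := by
    refine fun i t => Set.Countable.union ?_ ?_
    · exact Set.Countable.biUnion (Finset.countable_toSet _) fun t' _ => hc i t'
    · refine Set.Countable.biUnion (Finset.countable_toSet _) fun s _ => Set.Countable.insert _ ?_
      rcases s with x | φ
      · exact (hN i x).image _
      · exact Set.countable_empty
  let adds : Finset (S ⊕ StrongDual ℝ S) → Set (S ⊕ StrongDual ℝ S) := fun t =>
    {s | ∃ x y, Sum.inl x ∈ t ∧ Sum.inl y ∈ t ∧ s = Sum.inl (x + y)}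
  have hadds : ∀ t, (adds t).Countable := by
    intro t
    have hinl : {x : S | Sum.inl x ∈ t}.Countable :=
      t.countable_toSet.preimage_of_injOn (f := Sum.inl) Sum.inl_injective.injOn
    refine ((hinl.prod hinl).image fun p => Sum.inl (p.1 + p.2)).mono ?_
    rintro _ ⟨x, y, hx, hy, rfl⟩
    exact ⟨(x, y), ⟨hx, hy⟩, rfl⟩
  let supp : Finset (S ⊕ StrongDual ℝ S) → Set ι := fun t =>
    ⋃ s ∈ t, {i | InSupport incl proj (sumFunctionals incl D) i s}
  refine ⟨fun t => insert (Sum.inl 0) (adds t) ∪ ⋃ i ∈ supp t, lift incl proj i '' loc i t,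
    fun t => ?_, fun A hA hAc => ?_⟩
  · refine ((hadds t).insert _).union (Set.Countable.biUnion ?_ fun i _ => (hloc i t).image _)
    exact Set.Countable.biUnion (Finset.countable_toSet t) fun s _ => h.countable_inSupport D s
  · have hlift : ∀ i, (∃ s ∈ A, InSupport incl proj (sumFunctionals incl D) i s) →
        ∀ t : Finset (S ⊕ StrongDual ℝ S), (t : Set _) ⊆ A → ∀ s ∈ loc i t,
          lift incl proj i s ∈ A := by
      rintro i ⟨w, hw, hwi⟩ t ht s hs
      -- Adjoining the witness `w` forces `i` into the support of the finite set.
      have hins : ((insert w t : Finset _) : Set (S ⊕ StrongDual ℝ S)) ⊆ A := by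
        rw [Finset.coe_insert]
        exact Set.insert_subset hw ht
      refine hAc (insert w t) hins (Or.inr (Set.mem_biUnion (x := i) ?_ ⟨s, ?_, rfl⟩))
      · exact Set.mem_biUnion (x := w) (Finset.mem_insert_self _ _) hwi
      · have himg : t.image (component incl proj i) ⊆ (insert w t).image (component incl proj i) :=
          Finset.image_subset_image (Finset.subset_insert _ _)
        refine hs.imp (fun hs => ?_) fun hs => ?_
        · exact Set.biUnion_subset_biUnion_left
            (Finset.coe_subset.2 (Finset.powerset_mono.2 himg)) hs
        · exact Set.biUnion_subset_biUnion_left (Finset.coe_subset.2 himg) hs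
    have hback : ∀ i s, lift incl proj i s ∈ A → s ∈ component incl proj i '' A := fun i s hs =>
      ⟨_, hs, h.component_lift i s⟩
    refine h.splitsAt h0 ?_ (fun x y hx hy => ?_) fun i hi => ⟨?_, ?_, fun x hx => ?_⟩
    · exact hAc ∅ (by simp) (Or.inl (Or.inl rfl))
    · refine hAc {Sum.inl x, Sum.inl y} ?_ (Or.inl (Or.inr ⟨x, y, by simp, by simp, rfl⟩))
      rw [Finset.coe_pair]
      exact Set.pair_subset hx hy
    · refine hcsplit i _ (hA.image _) fun t' ht' s hs => ?_
      obtain ⟨t, ht, rfl⟩ := Finset.subset_set_image_iff.1 ht'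
      refine hback i s (hlift i hi t ht s (Or.inl (Set.mem_biUnion (x := t.image _) ?_ hs)))
      exact Finset.mem_coe.2 (Finset.mem_powerset_self _)
    · rintro _ ⟨s, hs, rfl⟩
      refine hlift i hi {s} (by simpa using hs) _ (Or.inr ?_)
      exact Set.mem_biUnion (x := component incl proj i s) (by simp) (Set.mem_insert _ _)
    · obtain ⟨s, hs, hsx⟩ := hx
      refine (hNorms i x).mono fun φ hφ => ⟨hND i x hφ, hback i _ ?_⟩
      refine hlift i hi {s} (by simpa using hs) _ (Or.inr ?_)
      refine Set.mem_biUnion (x := component incl proj i s) (by simp) (Set.mem_insert_of_mem _ ?_)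
      rw [hsx]
      exact ⟨φ, hφ, rfl⟩

theorem generatesProjections {D : ∀ i, Set (StrongDual ℝ (X i))} (h0 : ∀ i, 0 ∈ D i)
    (hD : ∀ i, IsOneNorming (D i)) (hgen : ∀ i, GeneratesProjections (D i)) :
    GeneratesProjections (sumFunctionals incl D) :=
  (h.splitsAtClosed h0 hD fun i => (hgen i).splitsAtClosed).generatesProjections

end IsMonotoneSum

end Sections

/-! ### Projectional skeletons of sums -/

section Skeletons

variable {X : Type*} [NormedAddCommGroup X] [NormedSpace ℝ X] {Γ : Type*}
  {P : Γ → X →L[ℝ] X}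

/-- The extension of a family of operators by `0` at the bottom index. -/
def botExtend (P : Γ → X →L[ℝ] X) : WithBot Γ → X →L[ℝ] X := WithBot.recBotCoe 0 P

@[simp] theorem botExtend_bot : botExtend P ⊥ = 0 := rfl

@[simp] theorem botExtend_coe (a : Γ) : botExtend P (a : WithBot Γ) = P a := rfl

variable [PartialOrder Γ]

/-- Coordinates of a strictly increasing sequence in a product are only monotone. Such a sequence is
eventually constant or has a strictly increasing cofinal subsequence. -/
theorem IsProjectionalSkeleton.exists_isLUB_of_monotone (h : IsProjectionalSkeleton P)
    {s : ℕ → Γ} (hs : Monotone s) : ∃ t, IsLUB (Set.range s) t ∧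
      Set.range (P t) ⊆ closure (⋃ n, Set.range (P (s n))) := by
  by_cases hev : ∃ N, ∀ n, N ≤ n → s n = s N
  · obtain ⟨N, hN⟩ := hev
    refine ⟨s N, ⟨?_, fun b hb => hb ⟨N, rfl⟩⟩, ?_⟩
    · rintro _ ⟨n, rfl⟩
      rcases le_total n N with hn | hn
      · exact hs hn
      · exact (hN n hn).le
    · exact (Set.subset_iUnion (fun n => Set.range (P (s n))) N).trans subset_closure
  · push Not at hev
    have hev' : ∀ N, ∃ n, N < n ∧ s N < s n := fun N => by
      obtain ⟨n, hn, hne⟩ := hev N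
      exact ⟨n, lt_of_le_of_ne hn (by rintro rfl; exact hne rfl), lt_of_le_of_ne (hs hn) hne.symm⟩
    choose f hf hfs using hev'
    let k : ℕ → ℕ := fun n => f^[n] 0
    have hk : ∀ n, k (n + 1) = f (k n) := fun n => Function.iterate_succ_apply' _ _ _
    have hkmono : StrictMono k := strictMono_nat_of_lt_succ fun n => by rw [hk]; exact hf _
    have hskmono : StrictMono (s ∘ k) := strictMono_nat_of_lt_succ fun n => by
      rw [Function.comp_apply, Function.comp_apply, hk]; exact hfs _
    obtain ⟨t, ht, htr⟩ := h.continuous_sup (s ∘ k) hskmono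
    refine ⟨t, ⟨?_, fun b hb => ht.2 ?_⟩, ?_⟩
    · rintro _ ⟨n, rfl⟩
      exact (hs (hkmono.le_apply)).trans (ht.1 ⟨n, rfl⟩)
    · rintro _ ⟨n, rfl⟩
      exact hb ⟨k n, rfl⟩
    · rw [htr]
      exact closure_mono (Set.iUnion_subset fun n =>
        Set.subset_iUnion (fun n => Set.range (P (s n))) (k n))

namespace IsProjectionalSkeleton

variable (h : IsProjectionalSkeleton P)

include h

theorem botExtend_projection (a : WithBot Γ) (x : X) :
    botExtend P a (botExtend P a x) = botExtend P a x := by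
  induction a with
  | bot => simp
  | coe a => exact DFunLike.congr_fun (h.projection a) x

theorem botExtend_compatible {a b : WithBot Γ} (hab : a ≤ b) (x : X) :
    botExtend P a (botExtend P b x) = botExtend P a x ∧
      botExtend P b (botExtend P a x) = botExtend P a x := by
  induction a with
  | bot => simp
  | coe a =>
    induction b with
    | bot => simp at hab
    | coe b =>
      have := h.compatible a b (WithBot.coe_le_coe.1 hab)
      exact ⟨DFunLike.congr_fun this.1 x, DFunLike.congr_fun this.2 x⟩

/-- The last clause keeps the support of a coordinatewise upper bound inside the union of the two
supports. -/
theorem botExtend_directed (a b : WithBot Γ) :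
    ∃ v, a ≤ v ∧ b ≤ v ∧ (a = ⊥ → b = ⊥ → v = ⊥) := by
  induction a with
  | bot => exact ⟨b, bot_le, le_rfl, fun _ hb => hb⟩
  | coe a =>
    induction b with
    | bot => exact ⟨a, le_rfl, bot_le, fun ha _ => ha⟩
    | coe b =>
      obtain ⟨v, hav, hbv⟩ := h.directed a b
      exact ⟨v, WithBot.coe_le_coe.2 hav, WithBot.coe_le_coe.2 hbv,
        fun ha => absurd ha WithBot.coe_ne_bot⟩

theorem botExtend_separable (a : WithBot Γ) :
    TopologicalSpace.IsSeparable (Set.range (botExtend P a)) := by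
  induction a with
  | bot =>
    refine (Set.Countable.isSeparable (Set.countable_singleton (0 : X))).mono ?_
    rintro _ ⟨x, rfl⟩
    rfl
  | coe a => exact h.separable a

/-- Discard the initial terms equal to `⊥` and use the original skeleton. The middle clause ensures
countable support of coordinatewise suprema. -/
theorem botExtend_exists_isLUB {s : ℕ → WithBot Γ} (hs : Monotone s) :
    ∃ t, IsLUB (Set.range s) t ∧ (t ≠ ⊥ → ∃ n, s n ≠ ⊥) ∧
      Set.range (botExtend P t) ⊆ closure (⋃ n, Set.range (botExtend P (s n))) := by
  by_cases hbot : ∀ n, s n = ⊥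
  · refine ⟨⊥, ⟨?_, fun _ _ => bot_le⟩, fun hne => absurd rfl hne, ?_⟩
    · rintro _ ⟨n, rfl⟩
      exact (hbot n).le
    · refine Set.Subset.trans ?_ subset_closure
      have := Set.subset_iUnion (fun n => Set.range (botExtend P (s n))) 0
      rwa [hbot 0] at this
  · push Not at hbot
    obtain ⟨N, hN⟩ := hbot
    have hne : ∀ n, s (n + N) ≠ ⊥ := fun n h0 => hN (le_bot_iff.1 (h0 ▸ hs (Nat.le_add_left N n)))
    have hcoe : ∀ n, ((s (n + N)).unbot (hne n) : WithBot Γ) = s (n + N) := fun n =>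
      WithBot.coe_unbot _ _
    have hmono : Monotone fun n => (s (n + N)).unbot (hne n) := fun m n hmn => by
      rw [← WithBot.coe_le_coe, hcoe, hcoe]
      exact hs (Nat.add_le_add_right hmn N)
    obtain ⟨t, ht, htr⟩ := h.exists_isLUB_of_monotone hmono
    refine ⟨t, ⟨?_, fun b hb => ?_⟩, fun _ => ⟨N, hN⟩, ?_⟩
    · rintro _ ⟨n, rfl⟩
      refine (hs (Nat.le_add_right n N)).trans ?_
      rw [← hcoe n]
      exact WithBot.coe_le_coe.2 (ht.1 ⟨n, rfl⟩)
    · have hbN : s N ≤ b := hb ⟨N, rfl⟩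
      induction b with
      | bot => exact absurd (le_bot_iff.1 hbN) hN
      | coe b =>
        refine WithBot.coe_le_coe.2 (ht.2 ?_)
        rintro _ ⟨n, rfl⟩
        rw [← WithBot.coe_le_coe, hcoe]
        exact hb ⟨n + N, rfl⟩
    · rw [botExtend_coe]
      refine htr.trans (closure_mono (Set.iUnion_subset fun n => ?_))
      rw [← botExtend_coe (P := P), hcoe]
      exact Set.subset_iUnion (fun n => Set.range (botExtend P (s n))) (n + N)

end IsProjectionalSkeleton

end Skeletons

/-! ### The coordinatewise skeleton of a monotone sum -/

section SumSkeleton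

variable {ι : Type u} {X : ι → Type u} [∀ i, NormedAddCommGroup (X i)] [∀ i, NormedSpace ℝ (X i)]
  {S : Type u} [NormedAddCommGroup S] [NormedSpace ℝ S]
  {incl : ∀ i, X i →L[ℝ] S} {proj : ∀ i, S →L[ℝ] X i}

namespace IsMonotoneSum

variable (h : IsMonotoneSum incl proj)

include h

/-- Monotonicity gives existence and the norm bound; linearity follows because components determine
an element. -/
theorem exists_diagonal (T : ∀ i, X i →L[ℝ] X i) (hT : ∀ i, ‖T i‖ ≤ 1) :
    ∃ Q : S →L[ℝ] S, ‖Q‖ ≤ 1 ∧ ∀ i x, proj i (Q x) = T i (proj i x) := by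
  choose q hq hqn using fun x => h.exists_of_norm_le x (fun i => T i (proj i x)) fun i =>
    ((T i).le_opNorm _).trans (mul_le_of_le_one_left (norm_nonneg _) (hT i))
  let Q : S →ₗ[ℝ] S :=
    { toFun := q
      map_add' := fun x y => h.ext fun i => by simp only [map_add, hq]
      map_smul' := fun c x => h.ext fun i => by simp only [map_smul, hq, RingHom.id_apply] }
  refine ⟨Q.mkContinuous 1 fun x => by rw [one_mul]; exact hqn x,
    Q.mkContinuous_norm_le zero_le_one _, fun i x => hq x i⟩

theorem hasProjectionalSkeleton (hX : ∀ i, HasProjectionalSkeleton 1 (X i)) :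
    HasProjectionalSkeleton 1 S := by
  classical
  choose Γ instΓ P hP hP1 using hX
  let T : ∀ i, WithBot (Γ i) → X i →L[ℝ] X i := fun i => botExtend (P i)
  have hT1 : ∀ i a, ‖T i a‖ ≤ 1 := by
    intro i a
    induction a with
    | bot => simp [T]
    | coe a => exact hP1 i a
  let Δ := {s : ∀ i, WithBot (Γ i) // {i | s i ≠ ⊥}.Countable}
  choose Q hQ1 hQ using fun s : Δ => h.exists_diagonal (fun i => T i (s.1 i)) fun i => hT1 i _
  have hle : ∀ {s t : Δ}, s ≤ t ↔ ∀ i, s.1 i ≤ t.1 i := Iff.rfl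
  have hproj : ∀ (s : Δ) x, Q s (Q s x) = Q s x := fun s x => h.ext fun i => by
    simp only [hQ]
    exact (hP i).botExtend_projection _ _
  have hcompat : ∀ s t : Δ, s ≤ t → (Q s).comp (Q t) = Q s ∧ (Q t).comp (Q s) = Q s := by
    intro s t hst
    constructor
    · ext x
      refine h.ext fun i => ?_
      simp only [ContinuousLinearMap.comp_apply, hQ]
      exact ((hP i).botExtend_compatible (hle.1 hst i) _).1
    · ext x
      refine h.ext fun i => ?_
      simp only [ContinuousLinearMap.comp_apply, hQ]
      exact ((hP i).botExtend_compatible (hle.1 hst i) _).2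
  have hincl : ∀ (s : Δ) i v, incl i (T i (s.1 i) v) = Q s (incl i v) := by
    intro s i v
    refine h.ext fun j => ?_
    rw [hQ]
    rcases eq_or_ne j i with rfl | hji
    · rw [h.proj_incl, h.proj_incl]
    · rw [h.proj_incl_of_ne j i _ hji, h.proj_incl_of_ne j i _ hji, map_zero]
  refine ⟨Δ, inferInstance, Q, ⟨fun s t => ?_, fun s => ?_, fun x => ?_, fun s => ?_, hcompat,
    fun s hs => ?_⟩, hQ1⟩
  · choose v hsv htv hv using fun i => (hP i).botExtend_directed (s.1 i) (t.1 i)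
    refine ⟨⟨v, (s.2.union t.2).mono fun i hi => ?_⟩, hsv, htv⟩
    by_contra hcon
    simp only [Set.mem_union, Set.mem_ofPred_eq, not_or, not_not] at hcon
    exact hi (hv i hcon.1 hcon.2)
  · ext x
    exact hproj s x
  · choose a ha using fun i => (hP i).covers (proj i x)
    -- The bottom index is used where `x` vanishes, so the support stays countable.
    refine ⟨⟨fun i => if proj i x = 0 then ⊥ else a i, (h.countable_support x).mono fun i hi h0 =>
      hi (if_pos h0)⟩, x, h.ext fun i => ?_⟩
    rw [hQ]
    dsimp only
    split_ifs with h0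
    · rw [h0, map_zero]
    · obtain ⟨w, hw⟩ := ha i
      rw [← hw]
      exact DFunLike.congr_fun ((hP i).projection (a i)) w
  · have hcount : Countable {i | s.1 i ≠ ⊥} := s.2.to_subtype
    have hsep : TopologicalSpace.IsSeparable
        (⋃ i : {i | s.1 i ≠ ⊥}, incl i.1 '' Set.range (T i.1 (s.1 i.1))) :=
      TopologicalSpace.IsSeparable.iUnion fun i =>
        ((hP i.1).botExtend_separable (s.1 i.1)).image (incl i.1).continuous
    refine (hsep.span (R := ℝ)).closure.mono ?_
    rintro _ ⟨x, rfl⟩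
    refine mem_closure_of_tendsto (h.hasSum (Q s x)) (Filter.Eventually.of_forall fun F => ?_)
    refine Submodule.sum_mem _ fun i _ => ?_
    rw [hQ]
    by_cases hi : s.1 i = ⊥
    · simp [T, hi]
    · exact Submodule.subset_span (Set.mem_iUnion.2 ⟨⟨i, hi⟩, ⟨_, ⟨_, rfl⟩, rfl⟩⟩)
  · have hmono : ∀ i, Monotone fun n => (s n).1 i := fun i m n hmn => hle.1 (hs.monotone hmn) i
    choose t ht htbot htr using fun i => (hP i).botExtend_exists_isLUB (hmono i)
    let t' : Δ := ⟨t, (Set.countable_iUnion fun n => (s n).2).mono fun i hi =>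
      Set.mem_iUnion.2 (htbot i hi)⟩
    have hst : ∀ n, s n ≤ t' := fun n => hle.2 fun i => (ht i).1 ⟨n, rfl⟩
    refine ⟨t', ⟨?_, fun b hb => hle.2 fun i => (ht i).2 ?_⟩, Set.Subset.antisymm ?_ ?_⟩
    · rintro _ ⟨n, rfl⟩
      exact hst n
    · rintro _ ⟨n, rfl⟩
      exact hle.1 (hb ⟨n, rfl⟩) i
    -- The ranges increase, so the closure of their union is a closed subspace and it suffices to
    -- place each component of `Q t' x` in it.
    · let R : ℕ → Submodule ℝ S := fun n => LinearMap.range (Q (s n)).toLinearMap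
      have hdir : Directed (· ≤ ·) R := by
        refine Monotone.directed_le fun m n hmn => ?_
        rintro _ ⟨x, rfl⟩
        exact ⟨Q (s m) x, DFunLike.congr_fun (hcompat _ _ (hs.monotone hmn)).2 x⟩
      have hcoe : ((⨆ n, R n : Submodule ℝ S) : Set S) = ⋃ n, Set.range (Q (s n)) := by
        rw [Submodule.coe_iSup_of_directed R hdir]
        rfl
      rw [← hcoe, ← Submodule.topologicalClosure_coe]
      rintro _ ⟨x, rfl⟩
      refine (Submodule.isClosed_topologicalClosure _).mem_of_tendsto (h.hasSum (Q t' x))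
        (Filter.Eventually.of_forall fun F => Submodule.sum_mem _ fun i _ => ?_)
      rw [← SetLike.mem_coe, Submodule.topologicalClosure_coe, hcoe, hQ]
      refine map_mem_closure (incl i).continuous (htr i ⟨proj i x, rfl⟩) fun y hy => ?_
      obtain ⟨n, v, rfl⟩ := Set.mem_iUnion.1 hy
      exact Set.mem_iUnion.2 ⟨n, incl i v, (hincl (s n) i v).symm⟩
    · have hclosed : IsClosed (Set.range (Q t')) := by
        have : Set.range (Q t') = {x | Q t' x = x} := by
          ext x
          constructor
          · rintro ⟨y, rfl⟩
            exact hproj t' y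
          · exact fun hx => ⟨x, hx⟩
        rw [this]
        exact isClosed_eq (Q t').continuous continuous_id
      refine hclosed.closure_subset_iff.2 (Set.iUnion_subset fun n => ?_)
      rintro _ ⟨x, rfl⟩
      exact ⟨Q (s n) x, DFunLike.congr_fun (hcompat _ _ (hst n)).2 x⟩

end IsMonotoneSum

end SumSkeleton

/-! ### The `ℓ_p`-sums and the `c₀`-sum -/

section Instances

theorem exists_lp_of_norm_le {ι : Type*} (X : ι → Type*) [∀ i, NormedAddCommGroup (X i)]
    {p : ℝ≥0∞} [Fact (1 ≤ p)] (x : lp X p) (y : ∀ i, X i)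
    (hy : ∀ i, ‖y i‖ ≤ ‖x i‖) : ∃ z : lp X p, (∀ i, z i = y i) ∧ ‖z‖ ≤ ‖x‖ := by
  have hmem : Memℓp y p := (lp.memℓp x).mono' hy
  exact ⟨⟨y, hmem⟩, fun i => rfl, lp.norm_mono (zero_lt_one.trans_le Fact.out).ne' hy⟩

variable {ι : Type u} (X : ι → Type u) [∀ i, NormedAddCommGroup (X i)] [∀ i, NormedSpace ℝ (X i)]

theorem lpIncl_apply (p : ℝ≥0∞) [Fact (1 ≤ p)] (i j : ι) (x : X i) [DecidableEq ι] :
    lpIncl X p i x j = Pi.single (M := X) i x j := by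
  rcases eq_or_ne j i with rfl | hji
  · rw [Pi.single_eq_same]
    exact @lp.single_apply_self _ _ _ (Classical.decEq ι) p j x
  · rw [Pi.single_eq_of_ne hji]
    exact @lp.single_apply_ne _ _ _ (Classical.decEq ι) p i x j hji

theorem isMonotoneSum_lp (p : ℝ≥0∞) [Fact (1 ≤ p)] (hp : p ≠ ∞) :
    IsMonotoneSum (lpIncl X p) fun i => lp.evalCLM ℝ X p i where
  proj_incl i x := by
    classical
    exact (lpIncl_apply X p i i x).trans (Pi.single_eq_same i x)
  proj_incl_of_ne i j x hij := by
    classical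
    exact (lpIncl_apply X p j i x).trans (Pi.single_eq_of_ne hij x)
  hasSum x := by
    classical
    convert lp.hasSum_single hp x using 2 with i
    ext j
    rw [lpIncl_apply, lp.coeFn_single]
    rfl
  exists_of_norm_le := exists_lp_of_norm_le X

/-- Evaluation at a coordinate on the `c₀`-sum. -/
noncomputable def c0Proj (i : ι) : c0Sum X →L[ℝ] X i :=
  (lp.evalCLM ℝ X ∞ i).comp (c0Sum X).subtypeL

theorem isMonotoneSum_c0 : IsMonotoneSum (c0Incl X) (c0Proj X) where
  proj_incl i x := by
    classical
    exact (lpIncl_apply X ∞ i i x).trans (Pi.single_eq_same i x)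
  proj_incl_of_ne i j x hij := by
    classical
    exact (lpIncl_apply X ∞ j i x).trans (Pi.single_eq_of_ne hij x)
  hasSum x := by
    classical
    rw [HasSum, SummationFilter.unconditional_filter, Metric.tendsto_nhds]
    intro ε hε
    -- Once `F` contains these finitely many indices, the remaining tail has supremum norm at most
    -- `ε / 2`.
    have hx : {i | ¬ ‖x.1 i‖ < ε / 2}.Finite :=
      (Filter.Tendsto.eventually_lt_const (half_pos hε) x.2)
    filter_upwards [Filter.eventually_ge_atTop hx.toFinset] with F hF
    rw [dist_eq_norm]
    refine lt_of_le_of_lt ?_ (half_lt_self hε)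
    refine lp.norm_le_of_forall_le (half_pos hε).le fun j => ?_
    have hcoord : (∑ i ∈ F, c0Incl X i (c0Proj X i x) : c0Sum X).1 j =
        if j ∈ F then x.1 j else 0 := by
      have h1 : (∑ i ∈ F, c0Incl X i (c0Proj X i x) : c0Sum X).1 =
          ∑ i ∈ F, lpIncl X ∞ i (x.1 i) := by
        rw [Submodule.coe_sum]
        rfl
      rw [h1, lp.coeFn_sum, Finset.sum_apply]
      simp only [lpIncl_apply]
      exact Finset.sum_pi_single j (fun i => x.1 i) F
    change ‖(∑ i ∈ F, c0Incl X i (c0Proj X i x) : c0Sum X).1 j - x.1 j‖ ≤ ε / 2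
    rw [hcoord]
    split_ifs with hj
    · rw [sub_self, norm_zero]
      exact (half_pos hε).le
    · rw [zero_sub, norm_neg]
      by_contra hlt
      exact hj (hF (hx.mem_toFinset.2 fun h => hlt h.le))
  exists_of_norm_le x y hy := by
    obtain ⟨z, hz, hzx⟩ := exists_lp_of_norm_le X x.1 y hy
    refine ⟨⟨z, ?_⟩, hz, hzx⟩
    exact squeeze_zero (fun i => norm_nonneg _) (fun i => by rw [hz]; exact hy i) x.2

theorem norm_c0Proj_le (i : ι) (x : c0Sum X) : ‖c0Proj X i x‖ ≤ ‖x‖ :=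
  lp.norm_apply_le_norm ENNReal.top_ne_zero x.1 i

theorem exists_lt_norm_c0Proj (x : c0Sum X) (r : ℝ) (hrx : r < ‖x‖) (hr : 0 ≤ r) :
    ∃ i, r < ‖c0Proj X i x‖ := by
  by_contra! hcon
  exact absurd (lp.norm_le_of_forall_le (f := x.1) hr hcon) hrx.not_ge

end Instances

end ProjSkel

theorem mainTheorem6 {ι : Type u} (X : ι → Type u)
    [∀ i, NormedAddCommGroup (X i)] [∀ i, NormedSpace ℝ (X i)] [∀ i, CompleteSpace (X i)] :
    (∀ D : ∀ i, Set (StrongDual ℝ (X i)),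
      (∀ i, (0 : StrongDual ℝ (X i)) ∈ D i) →
      (∀ i, ProjSkel.IsOneNorming (D i)) →
      (∀ i, ProjSkel.GeneratesProjections (D i)) →
        (ProjSkel.IsOneNorming (ProjSkel.sumFunctionals (ProjSkel.c0Incl X) D) ∧
          ProjSkel.GeneratesProjections (ProjSkel.sumFunctionals (ProjSkel.c0Incl X) D)) ∧
        ((∀ i, ∀ φ ∈ D i, ∀ q : ℚ, |q| ≤ 1 → (q : ℝ) • φ ∈ D i) →
          ∀ (p : ℝ≥0∞) [Fact (1 ≤ p)], p ≠ ∞ →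
            ProjSkel.IsOneNorming (ProjSkel.sumFunctionals (ProjSkel.lpIncl X p) D) ∧
            ProjSkel.GeneratesProjections (ProjSkel.sumFunctionals (ProjSkel.lpIncl X p) D))) ∧
    ((∀ i, ProjSkel.HasProjectionalSkeleton 1 (X i)) →
      ProjSkel.HasProjectionalSkeleton 1 (ProjSkel.c0Sum X) ∧
      ∀ (p : ℝ≥0∞) [Fact (1 ≤ p)], p ≠ ∞ → ProjSkel.HasProjectionalSkeleton 1 (lp X p)) := by
  have hc0 := ProjSkel.isMonotoneSum_c0 X
  refine ⟨fun D h0 hD hgen => ⟨⟨?_, hc0.generatesProjections h0 hD hgen⟩, fun hsmul p _ hp => ?_⟩,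
    fun hX => ⟨hc0.hasProjectionalSkeleton hX, fun p _ hp =>
      (ProjSkel.isMonotoneSum_lp X p hp).hasProjectionalSkeleton hX⟩⟩
  · exact hc0.isOneNorming_of_norm_proj_le h0 hD (ProjSkel.norm_c0Proj_le X)
      (ProjSkel.exists_lt_norm_c0Proj X)
  · have hlp := ProjSkel.isMonotoneSum_lp X p hp
    exact ⟨hlp.isOneNorming_of_smul_mem h0 hD hsmul, hlp.generatesProjections h0 hD hgen⟩
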